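/- Let $\mathbf{k}$ be a field of characteristic zero, let $n,k\ge 1$ be integers, $\mathbf m=(m_1,\dots,m_n)$ with all $m_i\ge 2$, $R=\mathbf{k}[x_1,\dots,x_n]$, and $$I=(x_1^{m_1},\dots,x_n^{m_n},(x_1+\cdots+x_n)^k)\subset R .$$ **Critical monomials.** A monomial $s=x_1^{s_1}\cdots x_n^{s_n}$ is *$\mathbf m$-free* if $s_i<m_i$ for all $i$. A lattice path with vertices $P_0,\dots,P_n$, $P_a=(a,b_a)$, is *$\mathbf m$-admissible* if $b_0=0$ and, for each $1\le i\le n$, $b_i-b_{i-1}=1-e$ for some integer $0\le e\le m_i-1$. The $\mathbf m$-free monomial $s$ corresponds to the admissible path with $b_i-b_{i-1}=1-s_i$. Let $L(a)=-\tfrac k2+\sum_{i\le a}\tfrac{3-m_i}{2}$ for $0\le a\le n$, and let $P_a'=(a,2L(a)-b_a)$ be the reflection of $P_a$. The path of $s$, and $s$ itself, is *critical* if for some $0\le i\le n$ the path $(P_0,\dots,P_{i-1},P_i',\dots,P_n')$ is $\mathbf m$-admissible. Let $(M)$ be the ideal generated by all critical monomials and by $x_1^{m_1},\dots,x_n^{m_n}$.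 For $1\le j\le n$ let $\mathrm{Crit}_j$ be the set of $\mathbf m$-free monomials $s\in\mathbf{k}[x_1,\dots,x_j]$ such that 1. $x_j$ divides $s$ and $s_j=2\deg(s)-k-\sum_{i=1}^{j-1}m_i+(j-1)$; 2. for every $r<j$, the initial segment with $r$ steps of the path of $s$, i.e. the path of $x_1^{s_1}\cdots x_r^{s_r}$, is not critical (with respect to $(m_1,\dots,m_r)$ and $k$). **The polynomials $g_s$.** For $s=s'x_j^{s_j}\in\mathrm{Crit}_j$ with $s'\in\mathbf{k}[x_1,\dots,x_{j-1}]$ put $$g_s=\sum_{s''\mid s'}\lambda_{s''}\,s''\,\big[(x_j+\cdots+x_n)^{\deg(s)-\deg(s'')}\big],\qquad \lambda_{s''}=\left(\prod_{i=1}^{j-1}\frac{s_i!}{s''_i!}\binom{m_i-s''_i-1}{s_i-s''_i}\right)\frac{s_j!}{(\deg(s)-\deg(s''))!},$$ where $[\,\cdot\,]$ means that all terms divisible by one of $x_j^{m_j},\dots,x_n^{m_n}$ are deleted. **Theorem.** Let $\prec$ be any monomial order on $R$ with $x_1\succ\cdots\succ x_n$. Then: * the reduced Gröbner basis of $I$ with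 respect to $\prec$ is $$G=\Big\{x_j^{m_j}\;\Big|\;1\le j\le n,\ k+\sum_{i=1}^{j-1}(m_i-1)\ge m_j\Big\}\cup\bigcup_{j=1}^n\{g_s\mid s\in\mathrm{Crit}_j\},$$ which does not depend on the choice of such an order $\prec$; * $\mathrm{in}_\prec(I)=(M)$; * the minimal monomial generators of $\mathrm{in}_\prec(I)$ are the $x_j^{m_j}$ with $k+\sum_{i=1}^{j-1}(m_i-1)\ge m_j$ together with the monomials in $\bigcup_{j=1}^n\mathrm{Crit}_j$. -/

import Mathlib

open MvPolynomial

noncomputable section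

namespace CritPath

/-! Monomials in `x_0, …, x_{n-1}` are exponent vectors `Fin n →₀ ℕ`; the variable called `x_j`
in the usual `1`-based numbering is the one with index `j - 1 : Fin n`. -/

/-! ### The ideals -/

/-- The linear form `x_j + ⋯ + x_n` (sum of all variables with index at least `j`). -/
def tailSum (K : Type*) [Field K] {n : ℕ} (j : Fin n) : MvPolynomial (Fin n) K :=
  ∑ i ∈ Finset.Ici j, X i

/-- The monomial complete intersection `P = (x_1^{m_1}, …, x_n^{m_n})`. -/
def purePowerIdeal (K : Type*) [Field K] {n : ℕ} (m : Fin n → ℕ) :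
    Ideal (MvPolynomial (Fin n) K) :=
  Ideal.span (Set.range fun i => X i ^ m i)

/-- The almost complete intersection `I = (x_1^{m_1}, …, x_n^{m_n}, (x_1 + ⋯ + x_n)^k)`. -/
def mainIdeal (K : Type*) [Field K] {n : ℕ} (m : Fin n → ℕ) (k : ℕ) :
    Ideal (MvPolynomial (Fin n) K) :=
  Ideal.span (Set.range (fun i => X i ^ m i) ∪ {(∑ i, X i) ^ k})

/-! ### Initial ideals and reduced Gröbner bases -/

/-- The monomial ideal generated by a set of monomials. -/
def monomialIdeal (K : Type*) [Field K] {σ : Type*} (S : Set (σ →₀ ℕ)) :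
    Ideal (MvPolynomial σ K) :=
  Ideal.span ((fun s => monomial s (1 : K)) '' S)

/-- The initial ideal `in(I) = (in(f) ∣ f ∈ I, f ≠ 0)`. For `f ≠ 0`, `ord.degree f` is the exponent
of the largest monomial in the support of `f`. -/
def initialIdeal {K : Type*} [Field K] {σ : Type*} (ord : MonomialOrder σ)
    (I : Ideal (MvPolynomial σ K)) : Ideal (MvPolynomial σ K) :=
  monomialIdeal K (ord.degree '' {f | f ∈ I ∧ f ≠ 0})

/-- `S` is a minimal set of monomial generators of the ideal `J`. -/
def IsMinimalMonomialGenSet {K : Type*} [Field K] {σ : Type*} (S : Set (σ →₀ ℕ))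
    (J : Ideal (MvPolynomial σ K)) : Prop :=
  monomialIdeal K S = J ∧ ∀ T, T ⊂ S → monomialIdeal K T ≠ J

/-- `B` is a reduced Gröbner basis of `I` with respect to `ord`: a finite set of nonzero elements
of `I` whose initial monomials form the minimal monomial generating set of `in(I)`, each with
leading coefficient `1`, and with no non-leading monomial in `in(I)`. -/
structure IsReducedGroebnerBasis {K : Type*} [Field K] {σ : Type*} (ord : MonomialOrder σ)
    (I : Ideal (MvPolynomial σ K)) (B : Set (MvPolynomial σ K)) : Prop where
  finite : B.Finite
  mem : ∀ g ∈ B, g ∈ I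
  ne_zero : ∀ g ∈ B, g ≠ 0
  minimal : IsMinimalMonomialGenSet (ord.degree '' B) (initialIdeal ord I)
  monic : ∀ g ∈ B, ord.leadingCoeff g = 1
  tail : ∀ g ∈ B, ∀ t ∈ g.support, t ≠ ord.degree g →
    monomial t (1 : K) ∉ initialIdeal ord I

/-! ### Lattice paths and critical monomials

A lattice path with `n` steps is recorded by the heights `P a` of its vertices `(a, P a)`,
`0 ≤ a ≤ n`. -/

/-- A monomial is `m`-free if every exponent satisfies `s_i < m_i`. -/
def IsFree {n : ℕ} (m s : Fin n → ℕ) : Prop := ∀ i, s i < m i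

/-- `m`-admissible paths: they start at the origin, and in the `i`-th step the height changes by
`1 - e` for some integer `0 ≤ e ≤ m_i - 1`. -/
def IsAdmissible {n : ℕ} (m : Fin n → ℕ) (P : Fin (n + 1) → ℚ) : Prop :=
  P 0 = 0 ∧ ∀ i : Fin n, ∃ e : ℕ, e < m i ∧ P i.succ = P i.castSucc + (1 - (e : ℚ))

/-- The path of a monomial: its `i`-th step changes the height by `1 - s_i`. -/
def monomialPath {n : ℕ} (s : Fin n → ℕ) (a : Fin (n + 1)) : ℚ :=
  ∑ i : Fin n with i.castSucc < a, (1 - (s i : ℚ))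

/-- The value at `x = a` of the continuous piecewise linear function on `[0, n]` with value `-k/2`
at `0` and with slope `(3 - m_i)/2` on the `i`-th unit interval. -/
def redLine {n : ℕ} (m : Fin n → ℕ) (k : ℕ) (a : Fin (n + 1)) : ℚ :=
  -(k : ℚ) / 2 + ∑ i : Fin n with i.castSucc < a, (3 - (m i : ℚ)) / 2

/-- The path obtained by reflecting the vertices with index at least `i` at the red line. -/
def reflectFrom {n : ℕ} (m : Fin n → ℕ) (k : ℕ) (i : Fin (n + 1)) (P : Fin (n + 1) → ℚ)
    (a : Fin (n + 1)) : ℚ :=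
  if a < i then P a else P a - 2 * (P a - redLine m k a)

/-- The `m`-free monomial `s` has a critical path: for some `i`, reflecting all vertices from the
`i`-th one on gives an `m`-admissible path. -/
def IsCritical {n : ℕ} (m : Fin n → ℕ) (k : ℕ) (s : Fin n → ℕ) : Prop :=
  IsFree m s ∧ ∃ i : Fin (n + 1), IsAdmissible m (reflectFrom m k i (monomialPath s))

/-- The ideal `(M)` generated by all monomials with a critical path and by the pure powers
`x_i^{m_i}`. -/
def criticalIdeal (K : Type*) [Field K] {n : ℕ} (m : Fin n → ℕ) (k : ℕ) :
    Ideal (MvPolynomial (Fin n) K) :=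
  monomialIdeal K {s | IsCritical m k s} ⊔ purePowerIdeal K m

/-- The degree condition: `s` is `m`-free, `x_j` divides `s`, and (in `1`-based numbering)
`s_j = 2 deg(x_1^{s_1} ⋯ x_j^{s_j}) - k - ∑_{i < j} m_i + (j - 1)`. -/
def CritBar {n : ℕ} (m : Fin n → ℕ) (k : ℕ) (j : Fin n) : Set (Fin n →₀ ℕ) :=
  {s | IsFree m s ∧ s j ≠ 0 ∧
    (s j : ℤ) = 2 * ∑ i ∈ Finset.Iic j, (s i : ℤ) - k - ∑ i ∈ Finset.Iio j, (m i : ℤ) + (j : ℕ)}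

/-- `Crit_j`: the monomials in `x_1, …, x_j` that satisfy the degree condition at `j` and whose
lattice path has no critical initial segment with fewer than `j` steps. The initial segment with
`r` steps is the path of `x_1^{s_1} ⋯ x_r^{s_r}`, taken with respect to `(m_1, …, m_r)`. -/
def Crit {n : ℕ} (m : Fin n → ℕ) (k : ℕ) (j : Fin n) : Set (Fin n →₀ ℕ) :=
  {s | s ∈ CritBar m k j ∧ (∀ i, j < i → s i = 0) ∧
    ∀ r : ℕ, ∀ hr : r ≤ (j : ℕ),
      ¬ IsCritical (fun i : Fin r => m (Fin.castLE (hr.trans j.isLt.le) i)) k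
        (fun i : Fin r => s (Fin.castLE (hr.trans j.isLt.le) i))}

/-! ### The explicit basis -/

/-- Reduction of a polynomial modulo `(x_j^{m_j}, …, x_n^{m_n})`: all terms divisible by one of
these powers are deleted. -/
def reducePowers {K : Type*} [Field K] {n : ℕ} (m : Fin n → ℕ) (j : Fin n)
    (f : MvPolynomial (Fin n) K) : MvPolynomial (Fin n) K :=
  ∑ t ∈ f.support with (∀ i, j ≤ i → t i < m i), monomial t (f.coeff t)

/-- The coefficient
`λ_t = (∏_{i < j} (s_i! / t_i!) * binom(m_i - t_i - 1, s_i - t_i)) * s_j! / (deg s - deg t)!`. -/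
def lam (K : Type*) [Field K] {n : ℕ} (m : Fin n → ℕ) (j : Fin n) (s t : Fin n →₀ ℕ) : K :=
  (∏ i ∈ Finset.Iio j, ((s i).factorial : K) / ((t i).factorial : K) *
      ((m i - t i - 1).choose (s i - t i) : K)) *
    (((s j).factorial : K) / ((s.degree - t.degree).factorial : K))

/-- The polynomial
`g_s = ∑_{t ∣ s'} λ_t t (x_j + ⋯ + x_n)^{deg s - deg t}` for a monomial `s = s' x_j^{s_j}` in
`x_1, …, x_j`, where the powers of `x_j + ⋯ + x_n` are reduced modulo
`(x_j^{m_j}, …, x_n^{m_n})`. -/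
def gPoly (K : Type*) [Field K] {n : ℕ} (m : Fin n → ℕ) (j : Fin n) (s : Fin n →₀ ℕ) :
    MvPolynomial (Fin n) K :=
  ∑ t ∈ Finset.Icc 0 (s.erase j),
    monomial t (lam K m j s t) * reducePowers m j (tailSum K j ^ (s.degree - t.degree))

/-- The indices `j` for which `x_j^{m_j}` is kept: those without `k + ∑_{i < j} (m_i - 1) < m_j`. -/
def keptIndices {n : ℕ} (m : Fin n → ℕ) (k : ℕ) : Set (Fin n) :=
  {j | ¬ k + ∑ i ∈ Finset.Iio j, (m i - 1) < m j}

/-- The candidate basis `G`. -/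
def basisG (K : Type*) [Field K] {n : ℕ} (m : Fin n → ℕ) (k : ℕ) :
    Set (MvPolynomial (Fin n) K) :=
  (fun j => X j ^ m j) '' keptIndices m k ∪ ⋃ j, gPoly K m j '' Crit m k j

/-- The candidate minimal generators of the initial ideal. -/
def minGens {n : ℕ} (m : Fin n → ℕ) (k : ℕ) : Set (Fin n →₀ ℕ) :=
  (fun j => Finsupp.single j (m j)) '' keptIndices m k ∪ ⋃ j, Crit m k j

end CritPath

end

/-!
Put `gap m s k p = k + ∑_{i < p} (m_i - 1 - 2 s_i)`: twice the height of the `p`-th vertex of the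
path of `s` above the red line. The reflection from vertex `a + 1` on is admissible exactly when
`gap a ≤ s_a < gap a + m_a`, and since the path starts above the line, an `m`-free monomial is
critical iff `gap a ≤ s_a` for some `a` (`isCritical_iff`). Likewise `Crit_j` consists of the
`m`-free monomials in the first `j` variables with `s_j = gap j` and `s_i < gap i` for `i < j`
(`mem_crit_iff`). So `minGens` is an antichain generating `(M)` (`isAntichain_minGens`,
`criticalIdeal_eq_monomialIdeal_minGens`).

*The polynomials `g_s` lie in `I`* (`gPoly_mem`). Modulo `I`, write
`x_j + ⋯ + x_n = L - ∑_{i < j} x_i` with `L ^ k = 0`. Up to the factor `s_j!`, `g_s` is the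
coefficient of `T ^ deg s` in
`exp(L T) ∏_{i < j} A_i(x_i T) exp(-x_i T)`, where `A_i` collects the factors of `λ` belonging to
`x_i`. A vanishing alternating sum of products of binomial coefficients shows that
`A_i(x_i T) exp(-x_i T)` has degree at most `m_i - 1 - s_i` in `T` when `x_i ^ m_i = 0`, and
`exp(L T)` has degree at most `k - 1`. The sum of these bounds is `deg s - 1`
(`sum_lamFactor_mul_pow_eq_zero`).

*Leading terms.* Every monomial of `g_s` other than `s` arises from `s` by moving degree to later
variables, so `s` leads in any order with `x_1 ≻ ⋯ ≻ x_n` (`degree_gPoly`), and every other monomial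
is `m`-free and not critical (`lt_gap_of_mem_support_gPoly`). In particular `(M) ⊆ in(I)`.

*Equality `in(I) = (M)`* (`exists_gap_le_degree`) is a count. Consider the coefficients of the
`m`-free monomials of degree `d`. The image of `I` under this projection is spanned by the
projections of `L ^ k w` for the `m`-free `w` of degree `d - k`, and elements of `I` with distinct
leading monomials that are `m`-free of degree `d` have independent projections. The reflection
principle (`card_freeOfDegree_le_card_critical`) provides at least as many critical monomials of
degree `d` as there are `w`, as soon as some `m`-free monomial of degree `d` is not critical; such a
monomial therefore cannot lead an element of `I`. The strong Lefschetz property is not needed.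
-/

noncomputable section

namespace CritPath

/-! ### Critical steps of a path -/

/-- Twice the height of the `p`-th vertex of the path of `s` above the red line. The index `p` is a
natural number, so that `gap m s k n` is available for the end point; for `p > n` the value is that
at `n`. -/
def gap {n : ℕ} (m s : Fin n → ℕ) (k p : ℕ) : ℤ :=
  k + ∑ i : Fin n with i.val < p, ((m i : ℤ) - 1 - 2 * s i)

section gap

variable {n k : ℕ} {m s t : Fin n → ℕ}

@[simp] lemma gap_zero : gap m s k 0 = k := by simp [gap]

lemma filter_val_lt_succ (a : Fin n) :
    (Finset.univ.filter fun i : Fin n => (i : ℕ) < a + 1) =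
      insert a (Finset.univ.filter fun i : Fin n => (i : ℕ) < a) := by
  ext i
  simp only [Finset.mem_filter, Finset.mem_univ, true_and, Finset.mem_insert, Fin.ext_iff]
  omega

lemma gap_succ (a : Fin n) : gap m s k (a + 1) = gap m s k a + (m a - 1 - 2 * s a) := by
  rw [gap, filter_val_lt_succ, Finset.sum_insert (by simp), gap]
  ring

lemma gap_congr {p : ℕ} (h : ∀ i : Fin n, (i : ℕ) < p → s i = t i) :
    gap m s k p = gap m t k p := by
  unfold gap
  congr 1
  refine Finset.sum_congr rfl fun i hi => ?_
  rw [h i (by simpa using hi)]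

lemma gap_mono {p : ℕ} (h : ∀ i : Fin n, (i : ℕ) < p → t i ≤ s i) :
    gap m s k p ≤ gap m t k p := by
  unfold gap
  gcongr with i hi
  exact_mod_cast h i (by simpa using hi)

lemma gap_eq_Iio (a : Fin n) :
    gap m s k a = k + ∑ i ∈ Finset.Iio a, ((m i : ℤ) - 1 - 2 * s i) := by
  unfold gap
  congr 2
  ext i
  simp

lemma gap_eq_univ : gap m s k n = k + ∑ i, ((m i : ℤ) - 1 - 2 * s i) := by
  unfold gap
  congr 2
  ext i
  simp

/-- As long as no critical step has occurred, the path stays strictly above the red line. -/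
lemma gap_pos (hk : 1 ≤ k) (hs : IsFree m s) {p : ℕ} (hp : p ≤ n)
    (h : ∀ i : Fin n, (i : ℕ) < p → (s i : ℤ) < gap m s k i) : 0 < gap m s k p := by
  induction p with
  | zero => simp; omega
  | succ p ih =>
    have h1 := gap_succ (m := m) (s := s) (k := k) ⟨p, hp⟩
    have h2 := h ⟨p, hp⟩ (by simp)
    have h3 := hs ⟨p, hp⟩
    simp only at h1 h2
    omega

/-- The gap of an initial segment is that of the whole path. -/
lemma gap_castLE {r : ℕ} (hr : r ≤ n) {p : ℕ} (hp : p ≤ r) :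
    gap (fun i : Fin r => m (Fin.castLE hr i)) (fun i : Fin r => s (Fin.castLE hr i)) k p =
      gap m s k p := by
  unfold gap
  congr 1
  refine Finset.sum_nbij (Fin.castLE hr) ?_ ?_ ?_ ?_
  · intro i; simp
  · intro i _ j _ h; exact Fin.castLE_injective hr h
  · intro i hi
    simp only [Finset.coe_filter, Finset.mem_univ, true_and, Set.mem_ofPred_eq] at hi
    exact ⟨⟨i, by omega⟩, by simpa using hi, rfl⟩
  · intro i _; rfl

lemma monomialPath_succ (a : Fin n) :
    monomialPath s a.succ = monomialPath s a.castSucc + (1 - (s a : ℚ)) := by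
  have := filter_val_lt_succ a
  unfold monomialPath
  simp only [Fin.lt_def, Fin.val_castSucc, Fin.val_succ]
  rw [this, Finset.sum_insert (by simp)]
  ring

lemma redLine_succ (a : Fin n) :
    redLine m k a.succ = redLine m k a.castSucc + (3 - (m a : ℚ)) / 2 := by
  have := filter_val_lt_succ a
  unfold redLine
  simp only [Fin.lt_def, Fin.val_castSucc, Fin.val_succ]
  rw [this, Finset.sum_insert (by simp)]
  ring

lemma gap_eq_path_sub_redLine (a : Fin (n + 1)) :
    (gap m s k a : ℚ) = 2 * (monomialPath s a - redLine m k a) := by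
  unfold gap monomialPath redLine
  simp only [Fin.lt_def, Fin.val_castSucc]
  push_cast
  have h : ∀ i : Fin n,
      ((m i : ℚ) - 1 - 2 * s i) = 2 * (1 - (s i : ℚ)) - 2 * ((3 - (m i : ℚ)) / 2) := by
    intro i
    ring
  simp only [h, Finset.sum_sub_distrib, ← Finset.mul_sum]
  ring

/-- Only the step into the first reflected vertex restricts: steps before it are unchanged, and
steps after it are replaced by their mirror images `m_i - 1 - s_i`. Reflecting the starting point
moves it away from the origin because `k ≠ 0`. -/
lemma isAdmissible_reflectFrom_iff (hk : 1 ≤ k) (hs : IsFree m s) (i : Fin (n + 1)) :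
    IsAdmissible m (reflectFrom m k i (monomialPath s)) ↔
      ∃ a : Fin n, i = a.succ ∧ gap m s k a ≤ s a ∧ (s a : ℤ) < gap m s k a + m a := by
  have hP0 : monomialPath s 0 = 0 := by simp [monomialPath]
  have hL0 : redLine m k 0 = -(k : ℚ) / 2 := by simp [redLine]
  constructor
  · rintro ⟨h0, h⟩
    rcases Fin.eq_zero_or_eq_succ i with rfl | ⟨a, rfl⟩
    · have : (k : ℚ) = 0 := by
        simp only [reflectFrom, lt_irrefl, if_false, hP0, hL0] at h0
        linarith
      have : k = 0 := by exact_mod_cast this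
      omega
    · refine ⟨a, rfl, ?_⟩
      obtain ⟨e, he, h⟩ := h a
      have hg := gap_eq_path_sub_redLine (m := m) (s := s) (k := k) a.castSucc
      simp only [Fin.val_castSucc] at hg
      simp only [reflectFrom, lt_irrefl, if_false, Fin.castSucc_lt_succ, if_true,
        monomialPath_succ, redLine_succ] at h
      have h2 : (e : ℚ) = (gap m s k a : ℚ) + m a - 1 - s a := by rw [hg]; linarith
      have h3 : (e : ℤ) = gap m s k a + m a - 1 - s a := by exact_mod_cast h2
      omega
  · rintro ⟨a, rfl, h1, h2⟩
    refine ⟨by simp [reflectFrom, hP0], fun b => ?_⟩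
    have hg := gap_eq_path_sub_redLine (m := m) (s := s) (k := k) b.castSucc
    simp only [Fin.val_castSucc] at hg
    have hb := hs b
    rcases lt_trichotomy b a with hba | rfl | hab
    · refine ⟨s b, hb, ?_⟩
      have h3 : b.succ < a.succ := by simpa using hba
      have h4 : b.castSucc < a.succ := by
        rw [Fin.lt_def] at *
        simp at *
        omega
      simp only [reflectFrom, h3, h4, if_true, monomialPath_succ]
    · obtain ⟨e, he⟩ : ∃ e : ℕ, (e : ℤ) = gap m s k b + m b - 1 - s b :=
        ⟨(gap m s k b + m b - 1 - s b).toNat, by omega⟩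
      refine ⟨e, by omega, ?_⟩
      have h2 : (e : ℚ) = (gap m s k b : ℚ) + m b - 1 - s b := by exact_mod_cast he
      simp only [reflectFrom, lt_irrefl, if_false, Fin.castSucc_lt_succ, if_true,
        monomialPath_succ, redLine_succ]
      rw [h2, hg]
      ring
    · refine ⟨m b - 1 - s b, by omega, ?_⟩
      have h3 : ¬ b.succ < a.succ := by simpa using hab.le
      have h4 : ¬ b.castSucc < a.succ := by
        rw [Fin.lt_def] at *
        simp at *
        omega
      have h5 : ((m b - 1 - s b : ℕ) : ℚ) = (m b : ℚ) - 1 - s b := by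
        have : ((m b - 1 - s b : ℕ) : ℤ) = (m b : ℤ) - 1 - s b := by omega
        exact_mod_cast this
      simp only [reflectFrom, h3, h4, if_false, monomialPath_succ, redLine_succ, h5]
      ring

/-- There is a first critical step. -/
lemma exists_first_gap_le (h : ∃ a : Fin n, gap m s k a ≤ s a) :
    ∃ a : Fin n, gap m s k a ≤ s a ∧ ∀ i < a, (s i : ℤ) < gap m s k i := by
  obtain ⟨a, ha⟩ := h
  obtain ⟨b, hb, hmin⟩ := WellFounded.has_min (wellFounded_lt (α := Fin n))
    {a | gap m s k a ≤ s a} ⟨a, ha⟩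
  exact ⟨b, hb, fun i hi => not_le.1 fun h => hmin i h hi⟩

/-- The upper bound `s_a < gap a + m_a` for an admissible reflection is automatic at the first `a`
with `gap a ≤ s_a`, where the gap is still positive. -/
lemma isCritical_iff (hk : 1 ≤ k) :
    IsCritical m k s ↔ IsFree m s ∧ ∃ a : Fin n, gap m s k a ≤ s a := by
  refine and_congr_right fun hs => ?_
  simp only [isAdmissible_reflectFrom_iff hk hs]
  constructor
  · rintro ⟨_, a, -, h, -⟩
    exact ⟨a, h⟩
  · intro h
    obtain ⟨a, ha, hlt⟩ := exists_first_gap_le h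
    have h0 := gap_pos hk hs a.isLt.le fun i hi => hlt i hi
    have := hs a
    exact ⟨a.succ, a, rfl, ha, by omega⟩

end gap

/-- The degree condition of `CritBar` says `s_j = gap j`; then `x_j ∣ s` is automatic, the gap being
positive there. -/
lemma mem_crit_iff {n k : ℕ} (hk : 1 ≤ k) {m : Fin n → ℕ} {j : Fin n} {s : Fin n →₀ ℕ} :
    s ∈ Crit m k j ↔ IsFree m s ∧ (s j : ℤ) = gap m s k j ∧ (∀ i, j < i → s i = 0) ∧
      ∀ i < j, (s i : ℤ) < gap m s k i := by
  have hdeg : (s j : ℤ) = 2 * ∑ i ∈ Finset.Iic j, (s i : ℤ) - k - ∑ i ∈ Finset.Iio j, (m i : ℤ) +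
      (j : ℕ) ↔ (s j : ℤ) = gap m s k j := by
    rw [gap_eq_Iio, ← Finset.Iio_insert, Finset.sum_insert (by simp)]
    simp only [Finset.sum_sub_distrib, ← Finset.mul_sum, Finset.sum_const, Fin.card_Iio,
      nsmul_eq_mul]
    constructor <;> intro h <;> linarith
  have hcrit : ∀ hs : IsFree m s, (∀ r : ℕ, ∀ hr : r ≤ (j : ℕ),
      ¬ IsCritical (fun i : Fin r => m (Fin.castLE (hr.trans j.isLt.le) i)) k
        (fun i : Fin r => s (Fin.castLE (hr.trans j.isLt.le) i))) ↔
      ∀ i < j, (s i : ℤ) < gap m s k i := by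
    intro hs
    constructor
    · intro h i hi
      by_contra hcon
      refine h j le_rfl ((isCritical_iff hk).2 ⟨fun i => hs _, ⟨i, hi⟩, ?_⟩)
      rw [gap_castLE _ (le_of_lt hi)]
      exact not_lt.1 hcon
    · intro h r hr hc
      obtain ⟨-, a, ha⟩ := (isCritical_iff hk).1 hc
      rw [gap_castLE _ a.isLt.le] at ha
      exact absurd (h (Fin.castLE (hr.trans j.isLt.le) a) (a.isLt.trans_le hr)) (not_lt.2 ha)
  constructor
  · rintro ⟨⟨hs, -, h⟩, h0, hc⟩
    exact ⟨hs, hdeg.1 h, h0, (hcrit hs).1 hc⟩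
  · rintro ⟨hs, h, h0, hc⟩
    have := gap_pos hk hs j.isLt.le fun i hi => hc i hi
    exact ⟨⟨hs, by omega, hdeg.2 h⟩, h0, (hcrit hs).2 hc⟩

/-! ### Divisibility among critical monomials -/

section combinatorics

variable {n k : ℕ} {m : Fin n → ℕ}

/-- Cut `t` after its first critical step `j` and lower the exponent of `x_j` to the gap. -/
lemma exists_crit_le (hk : 1 ≤ k) {t : Fin n →₀ ℕ} (ht : IsFree m t)
    (h : ∃ a : Fin n, gap m t k a ≤ t a) : ∃ j, ∃ s ∈ Crit m k j, s ≤ t := by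
  obtain ⟨j, hj, hlt⟩ := exists_first_gap_le h
  have hpos := gap_pos hk ht j.isLt.le fun i hi => hlt i hi
  set f : Fin n → ℕ := fun i => if i < j then t i else if i = j then (gap m t k j).toNat else 0
    with hf
  have hfj : f j = (gap m t k j).toNat := by simp [hf]
  have hflt : ∀ i < j, f i = t i := fun i hi => by simp [hf, hi]
  have hfgt : ∀ i, j < i → f i = 0 := fun i hi => by simp [hf, hi.not_gt, hi.ne']
  have hle : ∀ i, f i ≤ t i := by
    intro i
    rcases lt_trichotomy i j with hi | rfl | hi
    · exact (hflt i hi).le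
    · omega
    · rw [hfgt i hi]; exact Nat.zero_le _
  have hgap : ∀ i ≤ j, gap m f k i = gap m t k i := fun i hi =>
    gap_congr fun l hl => hflt l (lt_of_lt_of_le hl hi)
  refine ⟨j, Finsupp.equivFunOnFinite.symm f, (mem_crit_iff hk).2 ⟨?_, ?_, ?_, ?_⟩, hle⟩
  · exact fun i => (hle i).trans_lt (ht i)
  · change (f j : ℤ) = gap m f k j
    rw [hgap j le_rfl]
    omega
  · exact hfgt
  · intro i hi
    change (f i : ℤ) < gap m f k i
    rw [hgap i hi.le, hflt i hi]
    exact hlt i hi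

/-- Multiples of a monomial in `Crit_j` have a critical step at `j`: larger exponents only lower the
gap. -/
lemma gap_le_of_crit_le (hk : 1 ≤ k) {j : Fin n} {s t : Fin n →₀ ℕ} (hs : s ∈ Crit m k j)
    (h : s ≤ t) : gap m t k j ≤ t j := by
  have h1 := ((mem_crit_iff hk).1 hs).2.1
  have h2 : gap m t k j ≤ gap m s k j := gap_mono fun i _ => h i
  have h3 := h j
  omega

lemma crit_eq_of_le (hk : 1 ≤ k) {j l : Fin n} {s t : Fin n →₀ ℕ} (hs : s ∈ Crit m k j)
    (ht : t ∈ Crit m k l) (h : s ≤ t) : s = t := by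
  have h1 := gap_le_of_crit_le hk hs h
  obtain ⟨sfree, sj, s0, slt⟩ := (mem_crit_iff hk).1 hs
  obtain ⟨tfree, tl, t0, tlt⟩ := (mem_crit_iff hk).1 ht
  have hpos := gap_pos hk sfree j.isLt.le fun i hi => slt i hi
  have hsj := h j
  rcases lt_trichotomy j l with hjl | rfl | hjl
  · exact absurd (tlt j hjl) (not_lt.2 h1)
  · have hg : gap m t k j ≤ gap m s k j := gap_mono fun i _ => h i
    have hg' : gap m t k j = gap m s k j := by omega
    rw [gap_eq_Iio, gap_eq_Iio, add_right_inj] at hg'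
    have hle : ∀ i ∈ Finset.Iio j, ((m i : ℤ) - 1 - 2 * t i) ≤ (m i : ℤ) - 1 - 2 * s i :=
      fun i _ => by have := h i; omega
    have heq := (Finset.sum_eq_sum_iff_of_le hle).1 hg'
    ext i
    rcases lt_trichotomy i j with hi | rfl | hi
    · have := heq i (by simpa using hi)
      omega
    · omega
    · rw [s0 i hi, t0 i hi]
  · have := t0 j hjl
    omega

lemma gap_eq_of_eq_zero {s : Fin n → ℕ} {j : Fin n} (hm : ∀ i, 2 ≤ m i) (h : ∀ i < j, s i = 0) :
    gap m s k j = (k + ∑ i ∈ Finset.Iio j, (m i - 1) : ℕ) := by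
  rw [gap_eq_Iio]
  push_cast
  congr 1
  refine Finset.sum_congr rfl fun i hi => ?_
  rw [h i (by simpa using hi), Nat.cast_sub (by have := hm i; omega)]
  simp

/-- If `x_j ^ m_j` is not kept, then `x_j ^ (k + ∑_{i < j} (m_i - 1))` is in `Crit_j`. -/
lemma exists_crit_le_single (hk : 1 ≤ k) (hm : ∀ i, 2 ≤ m i) {j : Fin n}
    (hj : j ∉ keptIndices m k) :
    ∃ s ∈ Crit m k j, s ≤ Finsupp.single j (m j) := by
  have hj : k + ∑ i ∈ Finset.Iio j, (m i - 1) < m j := by simpa [keptIndices] using hj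
  refine ⟨Finsupp.single j (k + ∑ i ∈ Finset.Iio j, (m i - 1)),
    (mem_crit_iff hk).2 ⟨?_, ?_, ?_, ?_⟩, Finsupp.single_mono hj.le⟩
  · intro i
    rcases eq_or_ne i j with rfl | hi
    · simpa using hj
    · rw [Finsupp.single_eq_of_ne hi]
      have := hm i
      omega
  · rw [gap_eq_of_eq_zero hm fun i hi => Finsupp.single_eq_of_ne hi.ne]
    simp
  · exact fun i hi => Finsupp.single_eq_of_ne hi.ne'
  · intro i hi
    rw [gap_eq_of_eq_zero hm fun l hl => Finsupp.single_eq_of_ne (hl.trans hi).ne,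
      Finsupp.single_eq_of_ne hi.ne]
    push_cast
    positivity

lemma isAntichain_minGens (hk : 1 ≤ k) (hm : ∀ i, 2 ≤ m i) {s t : Fin n →₀ ℕ}
    (hs : s ∈ minGens m k) (ht : t ∈ minGens m k) (h : s ≤ t) : s = t := by
  simp only [minGens, Set.mem_union, Set.mem_image, Set.mem_iUnion] at hs ht
  rcases hs with ⟨j, hj, rfl⟩ | ⟨j, hs⟩
  · have hjt : m j ≤ t j := by simpa using h j
    rcases ht with ⟨l, hl, rfl⟩ | ⟨l, ht⟩
    · rcases eq_or_ne j l with rfl | hjl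
      · rfl
      · rw [Finsupp.single_eq_of_ne hjl] at hjt
        have := hm j
        omega
    · exact absurd (((mem_crit_iff hk).1 ht).1 j) (not_lt.2 hjt)
  · rcases ht with ⟨l, hl, rfl⟩ | ⟨l, ht⟩
    · exfalso
      obtain ⟨sfree, sj, s0, slt⟩ := (mem_crit_iff hk).1 hs
      have hpos := gap_pos hk sfree j.isLt.le fun i hi => slt i hi
      have h0 : ∀ i, i ≠ l → s i = 0 := fun i hi => by
        have := h i
        rw [Finsupp.single_eq_of_ne hi] at this
        omega
      have hjl : j = l := by
        by_contra hjl
        have := h0 j hjl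
        omega
      subst hjl
      rw [gap_eq_of_eq_zero hm fun i hi => h0 i hi.ne] at sj
      have h1 := sfree j
      have h2 : s j = k + ∑ i ∈ Finset.Iio j, (m i - 1) := by exact_mod_cast sj
      exact hl (by omega)
    · exact crit_eq_of_le hk hs ht h

/-- The monomials divisible by some candidate generator are those that are critical or not
`m`-free. -/
lemma exists_minGens_le_iff (hk : 1 ≤ k) (hm : ∀ i, 2 ≤ m i) {t : Fin n →₀ ℕ} :
    (∃ s ∈ minGens m k, s ≤ t) ↔ (IsFree m t → ∃ a : Fin n, gap m t k a ≤ t a) := by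
  constructor
  · rintro ⟨s, hs, hst⟩ ht
    simp only [minGens, Set.mem_union, Set.mem_image, Set.mem_iUnion] at hs
    rcases hs with ⟨j, -, rfl⟩ | ⟨j, hs⟩
    · have : m j ≤ t j := by simpa using hst j
      exact absurd (ht j) (not_lt.2 this)
    · exact ⟨j, gap_le_of_crit_le hk hs hst⟩
  · intro h
    have key : (∃ j, ∃ s ∈ Crit m k j, s ≤ t) → ∃ s ∈ minGens m k, s ≤ t := by
      rintro ⟨j, s, hs, hst⟩
      exact ⟨s, Or.inr (Set.mem_iUnion.2 ⟨j, hs⟩), hst⟩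
    by_cases ht : IsFree m t
    · exact key (exists_crit_le hk ht (h ht))
    · obtain ⟨j, hj⟩ : ∃ j, m j ≤ t j := by simpa [IsFree] using ht
      have hle : Finsupp.single j (m j) ≤ t := by simpa using hj
      by_cases hkept : j ∈ keptIndices m k
      · exact ⟨_, Or.inl ⟨j, hkept, rfl⟩, hle⟩
      · obtain ⟨s, hs, hsj⟩ := exists_crit_le_single hk hm hkept
        exact key ⟨j, s, hs, hsj.trans hle⟩

end combinatorics

/-! ### The reflection principle -/

section counting

variable {n k : ℕ} {m : Fin n → ℕ}

/-- The path of the complement `m - 1 - w`, with the mirror images of its steps after the `a`-th.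
The `a`-th step is chosen so that the vertices after it are reflected at the red line. -/
def reflectBefore (m : Fin n → ℕ) (k : ℕ) (w : Fin n → ℕ) (a : Fin n) : Fin n → ℕ := fun i =>
  if i < a then m i - 1 - w i
  else if i = a then (gap m (fun i => m i - 1 - w i) k a).toNat + w a else w i

/-- If `a` is the first critical step of the complement of `w`, then reflecting raises the degree of
`w` by `k`, and `a` is again the first critical step of the result. -/
lemma reflectBefore_spec (hk : 1 ≤ k) {w : Fin n → ℕ} (hw : IsFree m w) {a : Fin n}
    (ha : gap m (fun i => m i - 1 - w i) k a ≤ (m a - 1 - w a : ℕ))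
    (hlt : ∀ i < a, ((m i - 1 - w i : ℕ) : ℤ) < gap m (fun i => m i - 1 - w i) k i) :
    IsFree m (reflectBefore m k w a) ∧ ∑ i, reflectBefore m k w a i = ∑ i, w i + k ∧
      gap m (reflectBefore m k w a) k a = gap m (fun i => m i - 1 - w i) k a ∧
      gap m (reflectBefore m k w a) k a ≤ reflectBefore m k w a a ∧
      ∀ i < a, (reflectBefore m k w a i : ℤ) < gap m (reflectBefore m k w a) k i := by
  have hfree : IsFree m fun i => m i - 1 - w i := fun i => by
    have := hw i
    simp only
    omega
  have hpos := gap_pos hk hfree a.isLt.le fun i hi => hlt i hi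
  have hvlt : ∀ i < a, reflectBefore m k w a i = m i - 1 - w i := fun i hi => by
    simp [reflectBefore, hi]
  have hva : reflectBefore m k w a a = (gap m (fun i => m i - 1 - w i) k a).toNat + w a := by
    simp [reflectBefore]
  have hvgt : ∀ i, a < i → reflectBefore m k w a i = w i := fun i hi => by
    simp [reflectBefore, hi.not_gt, hi.ne']
  have hgap : ∀ i ≤ a, gap m (reflectBefore m k w a) k i = gap m (fun i => m i - 1 - w i) k i :=
    fun i hi => gap_congr fun l hl => hvlt l (lt_of_lt_of_le hl hi)
  have hwa := hw a
  refine ⟨fun i => ?_, ?_, hgap a le_rfl, ?_, fun i hi => ?_⟩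
  · have := hw i
    rcases lt_trichotomy i a with hi | rfl | hi
    · rw [hvlt i hi]; omega
    · omega
    · rw [hvgt i hi]; exact this
  · have h1 : ∑ i, ((reflectBefore m k w a i : ℤ) - w i) =
        ∑ i ∈ Finset.Iic a, ((reflectBefore m k w a i : ℤ) - w i) := by
      symm
      refine Finset.sum_subset (Finset.subset_univ _) fun i _ hi => ?_
      rw [hvgt i (by simpa using hi), sub_self]
    have h2 : ∑ i ∈ Finset.Iio a, ((reflectBefore m k w a i : ℤ) - w i) =
        - ∑ i ∈ Finset.Iio a, ((m i : ℤ) - 1 - 2 * ((m i - 1 - w i : ℕ) : ℤ)) := by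
      rw [← Finset.sum_neg_distrib]
      refine Finset.sum_congr rfl fun i hi => ?_
      have := hw i
      rw [hvlt i (by simpa using hi)]
      omega
    have h3 := gap_eq_Iio (m := m) (s := fun i => m i - 1 - w i) (k := k) a
    rw [← Finset.Iio_insert, Finset.sum_insert (by simp), h2, Finset.sum_sub_distrib] at h1
    zify
    omega
  · rw [hgap a le_rfl, hva]
    omega
  · rw [hgap i hi.le, hvlt i hi]
    exact hlt i hi

/-- The `m`-free exponent vectors of degree `d`. -/
def freeOfDegree (m : Fin n → ℕ) (d : ℕ) : Finset (Fin n → ℕ) :=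
  (Fintype.piFinset fun i => Finset.range (m i)).filter fun w => ∑ i, w i = d

lemma mem_freeOfDegree {d : ℕ} {w : Fin n → ℕ} :
    w ∈ freeOfDegree m d ↔ IsFree m w ∧ ∑ i, w i = d := by
  simp [freeOfDegree, IsFree]

open Classical in
/-- The reflection principle. If a noncritical `m`-free monomial of degree `e + k` exists, then
paths of that degree end above the red line, so the complements of the `m`-free monomials of degree
`e` end below it and are critical; reflecting them from the first critical step on is injective. -/
lemma card_freeOfDegree_le_card_critical (hk : 1 ≤ k) {u : Fin n → ℕ} (hu : IsFree m u)
    (hcrit : ∀ a : Fin n, (u a : ℤ) < gap m u k a) (e : ℕ) (he : e + k = ∑ i, u i) :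
    (freeOfDegree m e).card ≤
      ((freeOfDegree m (e + k)).filter fun v => ∃ a : Fin n, gap m v k a ≤ v a).card := by
  have hcompl : ∀ w ∈ freeOfDegree m e, IsFree m (fun i => m i - 1 - w i) ∧
      ∃ a : Fin n, gap m (fun i => m i - 1 - w i) k a ≤ (m a - 1 - w a : ℕ) := by
    intro w hw
    obtain ⟨hw, hdeg⟩ := mem_freeOfDegree.1 hw
    have hfree : IsFree m fun i => m i - 1 - w i := fun i => by
      have := hw i
      simp only
      omega
    refine ⟨hfree, ?_⟩
    by_contra! hcon
    have h1 := gap_pos hk hfree le_rfl fun i _ => hcon i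
    have h2 := gap_pos hk hu le_rfl fun i _ => hcrit i
    rw [gap_eq_univ] at h1 h2
    have h3 : ∑ i, ((m i : ℤ) - 1 - 2 * ((m i - 1 - w i : ℕ) : ℤ)) +
        ∑ i, ((m i : ℤ) - 1 - 2 * u i) = ∑ i, (2 * (w i : ℤ) - 2 * u i) := by
      rw [← Finset.sum_add_distrib]
      refine Finset.sum_congr rfl fun i _ => ?_
      have := hw i
      omega
    rw [Finset.sum_sub_distrib (fun i => 2 * (w i : ℤ)), ← Finset.mul_sum, ← Finset.mul_sum] at h3
    have h4 : (∑ i, (w i : ℤ)) = e := by exact_mod_cast hdeg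
    have h5 : (∑ i, (u i : ℤ)) = e + k := by exact_mod_cast he.symm
    omega
  -- A first critical step can be chosen globally only if there are variables at all.
  rcases isEmpty_or_nonempty (Fin n) with hn | hn
  · rw [Finset.card_eq_zero.2 (Finset.eq_empty_of_forall_notMem fun w hw =>
      hn.elim (hcompl w hw).2.choose)]
    exact Nat.zero_le _
  choose! a ha hlt using fun w hw => exists_first_gap_le (hcompl w hw).2
  have hspec := fun w hw => reflectBefore_spec hk (mem_freeOfDegree.1 hw).1 (ha w hw) (hlt w hw)
  refine Finset.card_le_card_of_injOn (fun w => reflectBefore m k w (a w)) ?_ ?_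
  · intro w hw
    obtain ⟨h1, h2, -, h4, -⟩ := hspec w hw
    refine Finset.mem_filter.2 ⟨mem_freeOfDegree.2 ⟨h1, ?_⟩, a w, h4⟩
    rw [h2, (mem_freeOfDegree.1 hw).2]
  · intro w hw w' hw' heq
    simp only at heq
    obtain ⟨-, -, h3, h4, h5⟩ := hspec w hw
    obtain ⟨-, -, h3', h4', h5'⟩ := hspec w' hw'
    -- The first critical step, and with it `w`, can be read off from the image.
    have haa : a w = a w' := by
      rcases lt_trichotomy (a w) (a w') with h | h | h
      · rw [heq] at h4
        exact absurd (h5' _ h) (not_lt.2 h4)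
      · exact h
      · rw [← heq] at h4'
        exact absurd (h5 _ h) (not_lt.2 h4')
    funext i
    have hi := congrFun heq i
    rw [heq, haa, h3'] at h3
    rw [haa] at hi
    have hwi := (mem_freeOfDegree.1 hw).1 i
    have hwi' := (mem_freeOfDegree.1 hw').1 i
    unfold reflectBefore at hi
    split_ifs at hi
    · omega
    · subst_vars
      omega
    · exact hi

end counting

/-! ### A vanishing sum from exponential series -/

/-- The `u`-th difference of the polynomial `binom(·, r)` of degree `r < u` vanishes. -/
lemma sum_alternating_choose_mul_choose_eq_zero {u r N : ℕ} (hr : r < u) (hu : u ≤ N) :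
    ∑ t ∈ Finset.range (u + 1), (-1 : ℤ) ^ t * u.choose t * (N - t).choose r = 0 := by
  have h : (fwdDiff 1)^[u] (fun x ↦ x.choose r : ℕ → ℤ) (N - u) = 0 := by
    obtain ⟨c, rfl⟩ := Nat.exists_eq_add_of_lt hr
    rw [show r + c + 1 = (c + 1) + r by ring, Function.iterate_add_apply]
    have := fwdDiff_iter_choose 0 r
    rw [add_zero] at this
    rw [this, Function.iterate_succ_apply]
    simp only [Nat.choose_zero_right, Nat.cast_one, fwdDiff_const]
    simp [fwdDiff_iter_eq_sum_shift]
  rw [fwdDiff_iter_eq_sum_shift, ← Finset.sum_range_reflect] at h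
  rw [← h]
  refine Finset.sum_congr rfl fun t ht => ?_
  have ht : t ≤ u := by simpa [Nat.lt_succ_iff] using ht
  rw [show u + 1 - 1 - t = u - t by omega, show u - (u - t) = t by omega, Nat.choose_symm ht,
    show N - u + (u - t) • 1 = N - t by simp; omega, smul_eq_mul]

section vanishing

lemma coeff_mul_eq_zero_of_lt {A : Type*} [CommRing A] {f g : PowerSeries A} {a b : ℕ}
    (hf : ∀ p, a < p → PowerSeries.coeff p f = 0) (hg : ∀ p, b < p → PowerSeries.coeff p g = 0) :
    ∀ p, a + b < p → PowerSeries.coeff p (f * g) = 0 := by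
  intro p hp
  rw [PowerSeries.coeff_mul]
  refine Finset.sum_eq_zero fun x hx => ?_
  have hx := Finset.HasAntidiagonal.mem_antidiagonal.1 hx
  rcases lt_or_ge a x.1 with h | h
  · rw [hf _ h, zero_mul]
  · rw [hg _ (by omega), mul_zero]

lemma coeff_prod_eq_zero_of_lt {A ι : Type*} [CommRing A] (I : Finset ι) {f : ι → PowerSeries A}
    {a : ι → ℕ} (hf : ∀ i ∈ I, ∀ p, a i < p → PowerSeries.coeff p (f i) = 0) :
    ∀ p, ∑ i ∈ I, a i < p → PowerSeries.coeff p (∏ i ∈ I, f i) = 0 := by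
  classical
  induction I using Finset.induction_on with
  | empty =>
    intro p hp
    simp only [Finset.sum_empty] at hp
    rw [Finset.prod_empty, PowerSeries.coeff_one, if_neg hp.ne']
  | insert i I hi ih =>
    rw [Finset.sum_insert hi, Finset.prod_insert hi]
    exact coeff_mul_eq_zero_of_lt (hf i (by simp)) (ih fun j hj => hf j (by simp [hj]))

variable (K : Type*) [Field K]

/-- The factor of `λ_t` belonging to a single variable. -/
def lamFactor (m s t : ℕ) : K :=
  (s.factorial : K) / (t.factorial : K) * ((m - t - 1).choose (s - t) : K)

variable [CharZero K] {Q : Type*} [CommRing Q] [Algebra K Q]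

/-- The power series `exp(a T)`. It takes its scalars from `K`, so that no `ℚ`-algebra structure on
`Q` has to be chosen. -/
def expSeries (a : Q) : PowerSeries Q :=
  PowerSeries.mk fun p => algebraMap K Q (1 / (p.factorial : K)) * a ^ p

lemma expSeries_mul (a b : Q) : expSeries K a * expSeries K b = expSeries K (a + b) := by
  let _ : Algebra ℚ Q := Algebra.compHom Q (algebraMap ℚ K)
  have h : ∀ a : Q, expSeries K a = PowerSeries.rescale a (PowerSeries.exp Q) := by
    intro a
    ext p
    rw [expSeries, PowerSeries.coeff_mk, PowerSeries.coeff_rescale, PowerSeries.coeff_exp, mul_comm]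
    congr 1
    rw [show algebraMap ℚ Q = (algebraMap K Q).comp (algebraMap ℚ K) from rfl]
    simp
  simp only [h, PowerSeries.exp_mul_exp_eq_exp_add]

lemma expSeries_zero : expSeries K (0 : Q) = 1 := by
  ext p
  rw [expSeries, PowerSeries.coeff_mk, PowerSeries.coeff_one]
  rcases eq_or_ne p 0 with rfl | hp
  · simp
  · simp [hp]

lemma prod_expSeries {ι : Type*} (I : Finset ι) (x : ι → Q) :
    ∏ i ∈ I, expSeries K (x i) = expSeries K (∑ i ∈ I, x i) := by
  classical
  induction I using Finset.induction_on with
  | empty => simp [expSeries_zero]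
  | insert i I hi ih => rw [Finset.prod_insert hi, Finset.sum_insert hi, ih, expSeries_mul]

omit [CharZero K] in
lemma coeff_expSeries_eq_zero {L : Q} {k : ℕ} (hL : L ^ k = 0) {p : ℕ} (hp : k ≤ p) :
    PowerSeries.coeff p (expSeries K L) = 0 := by
  rw [expSeries, PowerSeries.coeff_mk, pow_eq_zero_of_le hp hL, mul_zero]

/-- The polynomial `A(x T) = ∑_{t ≤ s} (s! / t!) binom(m - t - 1, s - t) (x T)^t`. -/
def lamSeries (m s : ℕ) (x : Q) : PowerSeries Q :=
  ∑ t ∈ Finset.range (s + 1), PowerSeries.monomial t (algebraMap K Q (lamFactor K m s t) * x ^ t)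

/-- The coefficient of `T ^ p` in `A(x T) exp(-x T)` vanishes for `p > m - 1 - s`: because
`x ^ m = 0` if `m ≤ p`, and for smaller `p` because it is, up to a factor, the sum
`∑_t (-1)^t binom(p, t) binom(m - 1 - t, m - 1 - s)`. -/
lemma coeff_lamSeries_mul_expSeries {m s : ℕ} (hs : s < m) {x : Q} (hx : x ^ m = 0) {p : ℕ}
    (hp : m - 1 - s < p) : PowerSeries.coeff p (lamSeries K m s x * expSeries K (-x)) = 0 := by
  rcases le_or_gt m p with hmp | hpm
  · rw [PowerSeries.coeff_mul]
    refine Finset.sum_eq_zero fun y hy => ?_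
    have hy := Finset.HasAntidiagonal.mem_antidiagonal.1 hy
    have h0 : x ^ (y.1 + y.2) = 0 := pow_eq_zero_of_le (by omega) hx
    rw [lamSeries, expSeries, map_sum, PowerSeries.coeff_mk, Finset.sum_mul]
    refine Finset.sum_eq_zero fun t _ => ?_
    rw [PowerSeries.coeff_monomial]
    split_ifs with h
    · subst h
      calc _ = algebraMap K Q (lamFactor K m s y.1) * algebraMap K Q (1 / (y.2.factorial : K)) *
            (-1) ^ y.2 * x ^ (y.1 + y.2) := by rw [neg_pow, pow_add]; ring
        _ = 0 := by rw [h0, mul_zero]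
    · simp
  · have hcoeff : ∀ t, PowerSeries.coeff t (lamSeries K m s x) =
        if t ≤ s then algebraMap K Q (lamFactor K m s t) * x ^ t else 0 := by
      intro t
      simp only [lamSeries, map_sum, PowerSeries.coeff_monomial]
      rw [Finset.sum_ite_eq]
      simp only [Finset.mem_range, Nat.lt_succ_iff]
    rw [PowerSeries.coeff_mul, Finset.Nat.sum_antidiagonal_eq_sum_range_succ
      (fun a b => PowerSeries.coeff a (lamSeries K m s x) * PowerSeries.coeff b (expSeries K (-x)))]
    have hsum := sum_alternating_choose_mul_choose_eq_zero (u := p) (r := m - 1 - s) (N := m - 1)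
      hp (by omega)
    have hK : ∑ t ∈ Finset.range (p + 1),
        (-1 : K) ^ t * p.choose t * (m - 1 - t).choose (m - 1 - s) = 0 := by
      exact_mod_cast congrArg (Int.cast (R := K)) hsum
    have key : ∀ t ∈ Finset.range (p + 1), PowerSeries.coeff t (lamSeries K m s x) *
        PowerSeries.coeff (p - t) (expSeries K (-x)) =
        algebraMap K Q ((s.factorial : K) / p.factorial * (-1) ^ p *
          ((-1 : K) ^ t * p.choose t * (m - 1 - t).choose (m - 1 - s))) * x ^ p := by
      intro t ht
      have ht : t ≤ p := by simpa [Nat.lt_succ_iff] using ht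
      rw [hcoeff, expSeries, PowerSeries.coeff_mk]
      split_ifs with hts
      · have h1 : (m - 1 - t).choose (m - 1 - s) = (m - t - 1).choose (s - t) := by
          rw [show m - t - 1 = m - 1 - t by omega, ← Nat.choose_symm (by omega : s - t ≤ m - 1 - t)]
          congr 1
          omega
        have h2 : (p.choose t : K) = p.factorial / (t.factorial * (p - t).factorial) :=
          Nat.cast_choose K ht
        have h3 : (-1 : K) ^ p * (-1) ^ t = (-1) ^ (p - t) := by
          obtain ⟨c, rfl⟩ := Nat.exists_eq_add_of_le ht
          rw [Nat.add_sub_cancel_left, pow_add, mul_comm ((-1 : K) ^ t), mul_assoc, ← mul_pow]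
          simp
        have h4 : x ^ p = x ^ t * x ^ (p - t) := by rw [← pow_add, Nat.add_sub_cancel' ht]
        have h5 : (-x) ^ (p - t) = algebraMap K Q ((-1) ^ (p - t)) * x ^ (p - t) := by
          rw [neg_pow]; simp
        have hf : (p.factorial : K) ≠ 0 := by exact_mod_cast p.factorial_ne_zero
        have h6 : (s.factorial : K) / p.factorial * (-1) ^ p *
          ((-1 : K) ^ t * p.choose t * (m - 1 - t).choose (m - 1 - s)) =
          lamFactor K m s t * (1 / ((p - t).factorial : K)) * (-1) ^ (p - t) := by
          rw [← h3, h1, h2, lamFactor]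
          field_simp
        rw [h6, h4, h5, map_mul, map_mul]
        ring
      · rw [Nat.choose_eq_zero_of_lt (by omega : m - 1 - t < m - 1 - s)]
        simp
    rw [Finset.sum_congr rfl key, ← Finset.sum_mul, ← map_sum, ← Finset.mul_sum, hK]
    simp

/-- The left-hand side is the coefficient of `T ^ d` in `exp(L T) ∏_i A_i(x_i T) exp(-x_i T)`, a
polynomial in `T` of degree at most `(k - 1) + ∑_i (m_i - 1 - s_i) = d - 1`. -/
theorem sum_lamFactor_mul_pow_eq_zero {ι : Type*} [Fintype ι] [DecidableEq ι] {m s : ι → ℕ}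
    {x : ι → Q} {L : Q} {k d : ℕ} (hk : 1 ≤ k) (hs : ∀ i, s i < m i) (hx : ∀ i, x i ^ m i = 0)
    (hL : L ^ k = 0) (hd : d = k + ∑ i, (m i - 1 - s i)) (hsd : ∑ i, s i ≤ d) :
    ∑ t ∈ Fintype.piFinset fun i => Finset.range (s i + 1),
      algebraMap K Q ((∏ i, lamFactor K (m i) (s i) (t i)) *
          (1 / ((d - ∑ i, t i).factorial : K))) *
        (∏ i, x i ^ t i) * (L - ∑ i, x i) ^ (d - ∑ i, t i) = 0 := by
  have hdeg : ∀ p, (k - 1) + ∑ i, (m i - 1 - s i) < p →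
      PowerSeries.coeff p (expSeries K L *
        ∏ i, (lamSeries K (m i) (s i) (x i) * expSeries K (-x i))) = 0 :=
    coeff_mul_eq_zero_of_lt (fun p hp => coeff_expSeries_eq_zero K hL (by omega))
      (coeff_prod_eq_zero_of_lt _ fun i _ p hp => coeff_lamSeries_mul_expSeries K (hs i) (hx i) hp)
  rw [← hdeg d (by omega), Finset.prod_mul_distrib, prod_expSeries, mul_left_comm, expSeries_mul,
    Finset.sum_neg_distrib, ← sub_eq_add_neg]
  simp only [lamSeries]
  rw [Finset.prod_univ_sum, Finset.sum_mul, map_sum]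
  refine Finset.sum_congr rfl fun t ht => ?_
  have hle : ∑ i, t i ≤ d := (Finset.sum_le_sum fun i _ => by
    have := Fintype.mem_piFinset.1 ht i
    simpa [Nat.lt_succ_iff] using this).trans hsd
  have hmon : ∏ i, PowerSeries.monomial (t i)
      (algebraMap K Q (lamFactor K (m i) (s i) (t i)) * x i ^ t i) =
      PowerSeries.monomial (∑ i, t i)
        (algebraMap K Q (∏ i, lamFactor K (m i) (s i) (t i)) * ∏ i, x i ^ t i) := by
    simp only [PowerSeries.monomial_eq_C_mul_X_pow, Finset.prod_mul_distrib,
      Finset.prod_pow_eq_pow_sum, map_mul, map_prod]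
  rw [hmon, PowerSeries.monomial_eq_C_mul_X_pow, mul_assoc (PowerSeries.C _),
    PowerSeries.coeff_C_mul,
    PowerSeries.coeff_X_pow_mul', if_pos hle, expSeries, PowerSeries.coeff_mk, map_mul]
  ring

end vanishing

/-! ### The polynomials `g_s` -/

section gPoly

variable {K : Type*} [Field K] {n k : ℕ} {m : Fin n → ℕ} {j : Fin n}

lemma coeff_reducePowers (f : MvPolynomial (Fin n) K) (u : Fin n →₀ ℕ) :
    (reducePowers m j f).coeff u = if ∀ i, j ≤ i → u i < m i then f.coeff u else 0 := by
  simp only [reducePowers, coeff_sum, coeff_monomial]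
  rw [Finset.sum_ite_eq']
  by_cases h : f.coeff u = 0
  · simp [h]
  · simp [h]

lemma purePowerIdeal_eq :
    purePowerIdeal K m = monomialIdeal K (Set.range fun i => Finsupp.single i (m i)) := by
  rw [purePowerIdeal, monomialIdeal, ← Set.range_comp]
  simp only [Function.comp_def, X_pow_eq_monomial]

lemma reducePowers_sub_mem (f : MvPolynomial (Fin n) K) :
    reducePowers m j f - f ∈ purePowerIdeal K m := by
  rw [purePowerIdeal_eq, monomialIdeal, mem_ideal_span_monomial_image]
  intro u hu
  rw [mem_support_iff, coeff_sub, coeff_reducePowers] at hu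
  obtain ⟨i, hi⟩ : ∃ i, m i ≤ u i := by
    by_contra! hcon
    rw [if_pos fun i _ => hcon i, sub_self] at hu
    exact hu rfl
  exact ⟨_, ⟨i, rfl⟩, by simpa using hi⟩

lemma coeff_mul_tailSum (p : MvPolynomial (Fin n) K) (u : Fin n →₀ ℕ) :
    (p * tailSum K j).coeff u =
      ∑ i ∈ Finset.Ici j, if i ∈ u.support then p.coeff (u - Finsupp.single i 1) else 0 := by
  simp only [tailSum, Finset.mul_sum, coeff_sum, coeff_mul_X']

lemma coeff_tailSum_pow_ne_zero {N : ℕ} {u : Fin n →₀ ℕ}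
    (h : ((tailSum K j) ^ N).coeff u ≠ 0) : u.degree = N ∧ ∀ i < j, u i = 0 := by
  induction N generalizing u with
  | zero =>
    rw [pow_zero, coeff_one] at h
    have : u = 0 := by
      by_contra hu
      exact h (if_neg (Ne.symm hu))
    simp [this]
  | succ N ih =>
    rw [pow_succ, coeff_mul_tailSum] at h
    obtain ⟨i, hi, h⟩ := Finset.exists_ne_zero_of_sum_ne_zero h
    have hiu : i ∈ u.support := by
      by_contra hiu
      exact h (if_neg hiu)
    rw [if_pos hiu] at h
    obtain ⟨h1, h2⟩ := ih h
    have hle : Finsupp.single i 1 ≤ u := by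
      have := Finsupp.mem_support_iff.1 hiu
      simp
      omega
    have hu := tsub_add_cancel_of_le hle
    constructor
    · rw [← hu, map_add, h1, Finsupp.degree_single]
    · intro l hl
      rw [← hu, Finsupp.add_apply, h2 l hl, Finsupp.single_eq_of_ne, add_zero]
      exact (hl.trans_le (Finset.mem_Ici.1 hi)).ne

lemma coeff_tailSum_pow_single (N : ℕ) :
    ((tailSum K j) ^ N).coeff (Finsupp.single j N) = 1 := by
  induction N with
  | zero => simp
  | succ N ih =>
    rw [pow_succ, coeff_mul_tailSum, Finset.sum_eq_single j]
    · rw [if_pos (by simp), ← Finsupp.single_tsub, Nat.add_sub_cancel, ih]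
    · intro i _ hi
      rw [if_neg]
      simp [Finsupp.single_eq_of_ne hi]
    · simp

lemma lam_eq (s t : Fin n →₀ ℕ) : lam K m j s t =
    (∏ i ∈ Finset.Iio j, lamFactor K (m i) (s i) (t i)) *
      (((s j).factorial : K) / ((s.degree - t.degree).factorial : K)) := rfl

lemma coeff_gPoly (s u : Fin n →₀ ℕ) : (gPoly K m j s).coeff u =
    ∑ t ∈ Finset.Icc 0 (s.erase j), if t ≤ u then
      lam K m j s t * (reducePowers m j (tailSum K j ^ (s.degree - t.degree))).coeff (u - t)
      else 0 := by
  simp only [gPoly, coeff_sum, coeff_monomial_mul']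

lemma erase_apply_le (s : Fin n →₀ ℕ) (i : Fin n) : s.erase j i ≤ s i := by
  rcases eq_or_ne i j with rfl | h
  · simp
  · rw [Finsupp.erase_ne h]

/-- The monomials of `g_s` are `m`-free of the degree of `s`, with smaller exponents than `s` before
`x_j`. -/
lemma of_mem_support_gPoly {s u : Fin n →₀ ℕ} (hs : IsFree m s) (hs0 : ∀ i, j < i → s i = 0)
    (hu : u ∈ (gPoly K m j s).support) :
    (∀ i < j, u i ≤ s i) ∧ IsFree m u ∧ u.degree = s.degree := by
  rw [mem_support_iff, coeff_gPoly] at hu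
  obtain ⟨t, ht, h⟩ := Finset.exists_ne_zero_of_sum_ne_zero hu
  have ht : t ≤ s.erase j := (Finset.mem_Icc.1 ht).2
  have hts : t ≤ s := fun i => (ht i).trans (erase_apply_le s i)
  have htu : t ≤ u := by
    by_contra htu
    exact h (if_neg htu)
  rw [if_pos htu] at h
  have h := right_ne_zero_of_mul h
  rw [coeff_reducePowers] at h
  have hred : ∀ i, j ≤ i → (u - t) i < m i := by
    by_contra hred
    exact h (if_neg hred)
  rw [if_pos hred] at h
  obtain ⟨h1, h2⟩ := coeff_tailSum_pow_ne_zero h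
  have hlt : ∀ i < j, u i = t i := fun i hi => by
    have h3 := h2 i hi
    have h4 := htu i
    rw [Finsupp.tsub_apply] at h3
    omega
  refine ⟨fun i hi => (hlt i hi).le.trans (hts i), fun i => ?_, ?_⟩
  · rcases lt_or_ge i j with hi | hi
    · rw [hlt i hi]
      exact (hts i).trans_lt (hs i)
    · have h3 := hred i hi
      have h4 : t i = 0 := by
        have := ht i
        rcases hi.eq_or_lt with rfl | hi
        · simpa using this
        · have h5 := hts i
          rw [hs0 i hi] at h5
          omega
      rw [Finsupp.tsub_apply] at h3
      omega
  · have h3 := congrArg Finsupp.degree (tsub_add_cancel_of_le htu)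
    have h4 : t.degree ≤ s.degree := Finsupp.degree_mono hts
    rw [map_add, h1] at h3
    omega

variable [CharZero K]

lemma coeff_gPoly_self {s : Fin n →₀ ℕ} (hs : IsFree m s) (hs0 : ∀ i, j < i → s i = 0) :
    (gPoly K m j s).coeff s = 1 := by
  have hfac : ∀ p : ℕ, (p.factorial : K) ≠ 0 := fun p => by exact_mod_cast p.factorial_ne_zero
  have hle : s.erase j ≤ s := erase_apply_le s
  have hsub : s - s.erase j = Finsupp.single j (s j) := by
    ext i
    rcases eq_or_ne i j with rfl | h
    · simp
    · simp [Finsupp.erase_ne h, Finsupp.single_eq_of_ne h]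
  have hdeg : s.degree - (s.erase j).degree = s j := by
    have h := congrArg Finsupp.degree (tsub_add_cancel_of_le hle)
    rw [map_add, hsub, Finsupp.degree_single] at h
    omega
  rw [coeff_gPoly, Finset.sum_eq_single (s.erase j)]
  · rw [if_pos hle, hdeg, hsub, coeff_reducePowers, if_pos, coeff_tailSum_pow_single, mul_one,
      lam_eq, hdeg, div_self (hfac _), mul_one]
    · refine Finset.prod_eq_one fun i hi => ?_
      have hi : i ≠ j := (Finset.mem_Iio.1 hi).ne
      rw [Finsupp.erase_ne hi, lamFactor, div_self (hfac _)]
      simp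
    · intro i hi
      rcases eq_or_ne i j with rfl | h
      · simpa using hs i
      · rw [Finsupp.single_eq_of_ne h]
        exact (Nat.zero_le _).trans_lt (hs i)
  · intro t ht hne
    have ht : t ≤ s.erase j := (Finset.mem_Icc.1 ht).2
    rw [if_pos (ht.trans hle), coeff_reducePowers]
    by_contra hcon
    have hcon := right_ne_zero_of_mul hcon
    have hcon : ((tailSum K j) ^ (s.degree - t.degree)).coeff (s - t) ≠ 0 := by
      intro h0
      rw [h0, ite_self] at hcon
      exact hcon rfl
    have h2 := (coeff_tailSum_pow_ne_zero hcon).2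
    refine hne (le_antisymm ht fun i => ?_)
    rcases lt_trichotomy i j with hi | rfl | hi
    · have := h2 i hi
      rw [Finsupp.erase_ne hi.ne]
      rw [Finsupp.tsub_apply] at this
      omega
    · simp
    · rw [Finsupp.erase_ne hi.ne', hs0 i hi]
      exact Nat.zero_le _
  · intro h
    exact absurd (Finset.mem_Icc.2 ⟨fun i => Nat.zero_le _, le_rfl⟩) h

/-- The vanishing result is applied in the quotient by `I`. To have one factor for each variable,
`x_i`, `m_i`, `s_i` are replaced by `0`, `1`, `0` for `i ≥ j`. -/
lemma gPoly_mem (hk : 1 ≤ k) {s : Fin n →₀ ℕ} (hs : IsFree m s) (hs0 : ∀ i, j < i → s i = 0)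
    (hj : (s j : ℤ) = gap m s k j) : gPoly K m j s ∈ mainIdeal K m k := by
  rw [← Ideal.Quotient.eq_zero_iff_mem]
  set π := Ideal.Quotient.mk (mainIdeal K m k) with hπ
  have hX : ∀ i, π (X i) ^ m i = 0 := fun i => by
    rw [← map_pow, hπ, Ideal.Quotient.eq_zero_iff_mem]
    exact Ideal.subset_span (Or.inl ⟨i, rfl⟩)
  have hL : π (∑ i, X i) ^ k = 0 := by
    rw [← map_pow, hπ, Ideal.Quotient.eq_zero_iff_mem]
    exact Ideal.subset_span (Or.inr rfl)
  have hred : ∀ f, π (reducePowers m j f) = π f := fun f => by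
    rw [hπ, Ideal.Quotient.eq]
    exact Ideal.span_mono Set.subset_union_left (reducePowers_sub_mem f)
  set m' : Fin n → ℕ := fun i => if i < j then m i else 1 with hm'
  set s' : Fin n → ℕ := fun i => s.erase j i with hs'
  set x : Fin n → MvPolynomial (Fin n) K ⧸ mainIdeal K m k :=
    fun i => if i < j then π (X i) else 0 with hx
  have hs'0 : ∀ i, ¬ i < j → s' i = 0 := fun i hi => by
    rcases (not_lt.1 hi).eq_or_lt with rfl | hi
    · simp [hs']
    · simp [hs', Finsupp.erase_ne hi.ne', hs0 i hi]
  have hs'1 : ∀ i, i < j → s' i = s i := fun i hi => by simp [hs', Finsupp.erase_ne hi.ne]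
  have hsums : ∑ i, s' i = ∑ i ∈ Finset.Iio j, s i := by
    rw [← Finset.sum_subset (Finset.subset_univ (Finset.Iio j)) fun i _ hi =>
      hs'0 i (by simpa using hi)]
    exact Finset.sum_congr rfl fun i hi => hs'1 i (by simpa using hi)
  have hsumm : ∑ i, (m' i - 1 - s' i) = ∑ i ∈ Finset.Iio j, (m i - 1 - s i) := by
    rw [← Finset.sum_subset (Finset.subset_univ (Finset.Iio j)) fun i _ hi => by
      simp only [Finset.mem_Iio] at hi
      simp [hm', hi]]
    refine Finset.sum_congr rfl fun i hi => ?_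
    have hi : i < j := by simpa using hi
    simp [hm', hi, hs'1 i hi]
  have hdeg : s.degree = ∑ i ∈ Finset.Iio j, s i + s j := by
    rw [Finsupp.degree_eq_sum, ← Finset.sum_subset (Finset.subset_univ (Finset.Iic j)) fun i _ hi =>
      hs0 i (by simpa using hi), ← Finset.Iio_insert, Finset.sum_insert (by simp), add_comm]
  have hd : s.degree = k + ∑ i, (m' i - 1 - s' i) := by
    rw [hsumm, hdeg]
    zify
    rw [hj, gap_eq_Iio, add_left_comm, ← Finset.sum_add_distrib]
    congr 1
    refine Finset.sum_congr rfl fun i _ => ?_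
    have := hs i
    omega
  have key := sum_lamFactor_mul_pow_eq_zero K (m := m') (s := s') (x := x) (d := s.degree) hk
    (fun i => by
      by_cases hi : i < j
      · simp only [hm', hi, if_true, hs'1 i hi]; exact hs i
      · simp [hm', hi, hs'0 i hi])
    (fun i => by
      by_cases hi : i < j
      · simp only [hm', hx, hi, if_true]; exact hX i
      · simp [hm', hx, hi]) hL hd (by omega)
  have htail : π (tailSum K j) = π (∑ i, X i) - ∑ i, x i := by
    have hIio : ∑ i, x i = ∑ i ∈ Finset.Iio j, π (X i) := by
      rw [← Finset.sum_subset (Finset.subset_univ (Finset.Iio j)) fun i _ hi => by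
        simp only [Finset.mem_Iio] at hi
        simp [hx, hi]]
      refine Finset.sum_congr rfl fun i hi => ?_
      have hi : i < j := by simpa using hi
      simp [hx, hi]
    have hcompl : (Finset.Ici j) = (Finset.Iio j)ᶜ := by ext; simp
    rw [hIio, tailSum, map_sum, map_sum, hcompl, eq_sub_iff_add_eq, Finset.sum_compl_add_sum]
  have hsum : π (gPoly K m j s) = algebraMap K _ ((s j).factorial : K) *
      ∑ t ∈ Fintype.piFinset fun i => Finset.range (s' i + 1),
      algebraMap K _ ((∏ i, lamFactor K (m' i) (s' i) (t i)) *
          (1 / ((s.degree - ∑ i, t i).factorial : K))) *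
        (∏ i, x i ^ t i) * (π (∑ i, X i) - ∑ i, x i) ^ (s.degree - ∑ i, t i) := by
    rw [gPoly, map_sum, Finset.mul_sum]
    refine Finset.sum_nbij' (fun t => ⇑t) (fun t => Finsupp.equivFunOnFinite.symm t) ?_ ?_ ?_ ?_ ?_
    · intro t ht
      simp only [Fintype.mem_piFinset, Finset.mem_range, Nat.lt_succ_iff]
      exact (Finset.mem_Icc.1 ht).2
    · intro t ht
      simp only [Fintype.mem_piFinset, Finset.mem_range, Nat.lt_succ_iff] at ht
      exact Finset.mem_Icc.2 ⟨fun i => Nat.zero_le _, ht⟩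
    · intro t _; ext; rfl
    · intro t _; rfl
    · intro t ht
      have ht : ∀ i, t i ≤ s' i := (Finset.mem_Icc.1 ht).2
      have ht0 : ∀ i, ¬ i < j → t i = 0 := fun i hi => by
        have := ht i
        rw [hs'0 i hi] at this
        omega
      rw [map_mul, hred, map_pow, htail, Finsupp.degree_eq_sum]
      have h1 : ∏ i, lamFactor K (m' i) (s' i) (t i) =
          ∏ i ∈ Finset.Iio j, lamFactor K (m i) (s i) (t i) := by
        rw [← Finset.prod_subset (Finset.subset_univ (Finset.Iio j)) fun i _ hi => by
          have hi : ¬ i < j := by simpa using hi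
          simp [hs'0 i hi, ht0 i hi, lamFactor]]
        refine Finset.prod_congr rfl fun i hi => ?_
        have hi : i < j := by simpa using hi
        simp [hm', hi, hs'1 i hi]
      have h2 : π (monomial t (lam K m j s t)) =
          algebraMap K _ (lam K m j s t) * ∏ i, x i ^ t i := by
        rw [monomial_eq, map_mul, Finsupp.prod_fintype _ _ (by simp), map_prod]
        congr 1
        refine Finset.prod_congr rfl fun i _ => ?_
        by_cases hi : i < j
        · simp [hx, hi]
        · simp [ht0 i hi]
      rw [h2, h1, lam_eq, Finsupp.degree_eq_sum, Finsupp.degree_eq_sum]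
      simp only [map_mul, map_one, div_eq_mul_inv]
      ring
  rw [hsum, key, mul_zero]

end gPoly

/-! ### Leading monomials -/

section order

variable {n : ℕ} (ord : MonomialOrder (Fin n))

lemma toSyn_eq_sum (u : Fin n →₀ ℕ) :
    ord.toSyn u = ∑ i, u i • ord.toSyn (Finsupp.single i 1) := by
  conv_lhs => rw [← Finsupp.univ_sum_single u]
  rw [map_sum]
  refine Finset.sum_congr rfl fun i _ => ?_
  rw [← map_nsmul, Finsupp.smul_single, smul_eq_mul, mul_one]

variable (hord : ∀ i j : Fin n, i < j →
  ord.toSyn (Finsupp.single j 1) < ord.toSyn (Finsupp.single i 1))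

include hord in
/-- Moving degree to `x_j` and later variables makes a monomial in `x_1, …, x_j` smaller. -/
lemma toSyn_le_toSyn {j : Fin n} {s u : Fin n →₀ ℕ} (hs0 : ∀ i, j < i → s i = 0)
    (hle : ∀ i < j, u i ≤ s i) (hdeg : u.degree = s.degree) : ord.toSyn u ≤ ord.toSyn s := by
  have hmono : ∀ i j : Fin n, i ≤ j →
      ord.toSyn (Finsupp.single j 1) ≤ ord.toSyn (Finsupp.single i 1) := by
    intro i j hij
    rcases hij.eq_or_lt with rfl | h
    · exact le_rfl
    · exact (hord i j h).le
  set e : Fin n → ord.syn := fun i => ord.toSyn (Finsupp.single i 1) with he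
  have hI : ∀ v : Fin n →₀ ℕ, ord.toSyn v =
      ∑ i ∈ Finset.Iio j, v i • e i + ∑ i ∈ Finset.Ici j, v i • e i := by
    intro v
    have : (Finset.Ici j) = (Finset.Iio j)ᶜ := by ext; simp
    rw [toSyn_eq_sum, this, Finset.sum_add_sum_compl]
  have hD : ∀ v : Fin n →₀ ℕ, v.degree = ∑ i ∈ Finset.Iio j, v i + ∑ i ∈ Finset.Ici j, v i := by
    intro v
    have : (Finset.Ici j) = (Finset.Iio j)ᶜ := by ext; simp
    rw [Finsupp.degree_eq_sum, this, Finset.sum_add_sum_compl]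
  have h1 : ∑ i ∈ Finset.Ici j, u i • e i ≤ (∑ i ∈ Finset.Ici j, u i) • e j := by
    rw [Finset.sum_smul]
    exact Finset.sum_le_sum fun i hi => nsmul_le_nsmul_right (hmono j i (by simpa using hi)) _
  have h2 : ∑ i ∈ Finset.Ici j, s i • e i = (∑ i ∈ Finset.Ici j, s i) • e j := by
    rw [Finset.sum_smul]
    refine Finset.sum_congr rfl fun i hi => ?_
    rcases (Finset.mem_Ici.1 hi).eq_or_lt with rfl | hi
    · rfl
    · simp [hs0 i hi]
  have h3 : (∑ i ∈ Finset.Iio j, (s i - u i)) • e j ≤ ∑ i ∈ Finset.Iio j, (s i - u i) • e i := by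
    rw [Finset.sum_smul]
    exact Finset.sum_le_sum fun i hi =>
      nsmul_le_nsmul_right (hmono i j (Finset.mem_Iio.1 hi).le) _
  have h4 : ∑ i ∈ Finset.Iio j, u i + ∑ i ∈ Finset.Iio j, (s i - u i) =
      ∑ i ∈ Finset.Iio j, s i := by
    rw [← Finset.sum_add_distrib]
    exact Finset.sum_congr rfl fun i hi => Nat.add_sub_cancel' (hle i (by simpa using hi))
  have h5 : ∑ i ∈ Finset.Iio j, u i • e i + ∑ i ∈ Finset.Iio j, (s i - u i) • e i =
      ∑ i ∈ Finset.Iio j, s i • e i := by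
    rw [← Finset.sum_add_distrib]
    refine Finset.sum_congr rfl fun i hi => ?_
    rw [← add_smul, Nat.add_sub_cancel' (hle i (by simpa using hi))]
  rw [hD, hD] at hdeg
  have h6 : ∑ i ∈ Finset.Ici j, u i =
    ∑ i ∈ Finset.Iio j, (s i - u i) + ∑ i ∈ Finset.Ici j, s i := by omega
  rw [hI u, hI s, h2, ← h5, add_assoc]
  refine add_le_add_right (h1.trans ?_) _
  rw [h6, add_smul]
  exact add_le_add_left h3 _

variable {K : Type*} [Field K] [CharZero K] {k : ℕ} {m : Fin n → ℕ} {j : Fin n}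

include hord in
lemma degree_gPoly (hk : 1 ≤ k) {s : Fin n →₀ ℕ} (hs : s ∈ Crit m k j) :
    ord.degree (gPoly K m j s) = s := by
  obtain ⟨sfree, -, s0, -⟩ := (mem_crit_iff hk).1 hs
  apply ord.toSyn.injective
  apply le_antisymm
  · rw [ord.degree_le_iff]
    intro u hu
    obtain ⟨h1, -, h3⟩ := of_mem_support_gPoly sfree s0 hu
    exact toSyn_le_toSyn ord hord s0 h1 h3
  · apply ord.le_degree
    rw [mem_support_iff, coeff_gPoly_self sfree s0]
    exact one_ne_zero

include hord in
lemma leadingCoeff_gPoly (hk : 1 ≤ k) {s : Fin n →₀ ℕ} (hs : s ∈ Crit m k j) :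
    ord.leadingCoeff (gPoly K m j s) = 1 := by
  obtain ⟨sfree, -, s0, -⟩ := (mem_crit_iff hk).1 hs
  rw [MonomialOrder.leadingCoeff, degree_gPoly ord hord hk hs, coeff_gPoly_self sfree s0]

omit [CharZero K] in
/-- The nonleading monomials of `g_s` have no critical step. With `δ` the degree moved from the
variables before `x_j`, the gap of `u` at `j` is `s_j + 2 δ`, while the exponents from `x_j` on add
up to `s_j + δ`. -/
lemma lt_gap_of_mem_support_gPoly (hk : 1 ≤ k) {s u : Fin n →₀ ℕ} (hs : s ∈ Crit m k j)
    (hu : u ∈ (gPoly K m j s).support) (hne : u ≠ s) (a : Fin n) : (u a : ℤ) < gap m u k a := by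
  obtain ⟨sfree, sj, s0, slt⟩ := (mem_crit_iff hk).1 hs
  obtain ⟨h1, ufree, h3⟩ := of_mem_support_gPoly sfree s0 hu
  have hgap : ∀ i ≤ j, gap m s k i ≤ gap m u k i := fun i hi =>
    gap_mono fun l hl => h1 l (lt_of_lt_of_le hl hi)
  rcases lt_or_ge a j with ha | ha
  · have := slt a ha
    have := h1 a ha
    have := hgap a ha.le
    omega
  have hdeg : ∀ v : Fin n →₀ ℕ, v.degree =
      ∑ i ∈ Finset.Iio j, v i + ∑ i ∈ Finset.Ici j, v i := by
    intro v
    have : (Finset.Ici j) = (Finset.Iio j)ᶜ := by ext; simp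
    rw [Finsupp.degree_eq_sum, this, Finset.sum_add_sum_compl]
  have hsI : ∑ i ∈ Finset.Ici j, s i = s j :=
    Finset.sum_eq_single_of_mem j (by simp) fun i hi hij =>
      s0 i (lt_of_le_of_ne (Finset.mem_Ici.1 hi) (Ne.symm hij))
  rw [hdeg, hdeg, hsI] at h3
  have hle : ∑ i ∈ Finset.Iio j, u i ≤ ∑ i ∈ Finset.Iio j, s i :=
    Finset.sum_le_sum fun i hi => h1 i (by simpa using hi)
  have hIco : ∑ i ∈ Finset.Ico j a, u i + u a ≤ ∑ i ∈ Finset.Ici j, u i := by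
    rw [add_comm, ← Finset.sum_insert (by simp)]
    refine Finset.sum_le_sum_of_subset fun i hi => ?_
    simp only [Finset.mem_insert, Finset.mem_Ico] at hi
    rcases hi with rfl | hi
    · simpa using ha
    · simpa using hi.1
  have hga : gap m u k a = gap m u k j + ∑ i ∈ Finset.Ico j a, ((m i : ℤ) - 1 - 2 * u i) := by
    have : Finset.Iio a = (Finset.Iio j) ∪ (Finset.Ico j a) := by
      ext i
      simp only [Finset.mem_Iio, Finset.mem_union, Finset.mem_Ico]
      constructor
      · intro h
        rcases lt_or_ge i j with h' | h'
        · exact Or.inl h'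
        · exact Or.inr ⟨h', h⟩
      · rintro (h | h)
        · exact h.trans_le ha
        · exact h.2
    rw [gap_eq_Iio, gap_eq_Iio, this, Finset.sum_union, add_assoc]
    rw [Finset.disjoint_left]
    intro i hi hi'
    exact absurd (Finset.mem_Iio.1 hi) (not_lt.2 (Finset.mem_Ico.1 hi').1)
  have hgj : gap m u k j =
      s j + 2 * (∑ i ∈ Finset.Iio j, (s i : ℤ) - ∑ i ∈ Finset.Iio j, (u i : ℤ)) := by
    rw [sj, gap_eq_Iio, gap_eq_Iio]
    simp only [Finset.sum_sub_distrib, ← Finset.mul_sum]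
    ring
  have hsplit : ∑ i ∈ Finset.Ico j a, ((m i : ℤ) - 1 - 2 * u i) =
      ∑ i ∈ Finset.Ico j a, ((m i : ℤ) - 1 - u i) - ∑ i ∈ Finset.Ico j a, (u i : ℤ) := by
    rw [← Finset.sum_sub_distrib]
    exact Finset.sum_congr rfl fun i _ => by ring
  have hnonneg : 0 ≤ ∑ i ∈ Finset.Ico j a, ((m i : ℤ) - 1 - u i) :=
    Finset.sum_nonneg fun i _ => by have := ufree i; omega
  zify at hle hIco h3
  rcases hle.lt_or_eq with hlt | heq
  · omega
  -- If `δ = 0`, then `u` and `s` agree before `j`, and `u j < s j ≤ m j - 1` gives strictness.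
  have huj : ∀ i < j, u i = s i := by
    have := (Finset.sum_eq_sum_iff_of_le (s := Finset.Iio j) (f := fun i => u i)
      (g := fun i => s i) fun i hi => h1 i (by simpa using hi)).1 (by exact_mod_cast heq)
    exact fun i hi => this i (by simpa using hi)
  have hujlt : u j < s j := by
    have hIci : Finset.Ici j = insert j (Finset.Ioi j) := by simp
    have hsum : u j + ∑ i ∈ Finset.Ioi j, u i = s j := by
      have : ∑ i ∈ Finset.Ici j, u i = s j := by zify; omega
      rwa [hIci, Finset.sum_insert (by simp)] at this
    refine lt_of_le_of_ne (by omega) fun h => hne ?_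
    have h0 : ∑ i ∈ Finset.Ioi j, u i = 0 := by omega
    rw [Finset.sum_eq_zero_iff] at h0
    ext i
    rcases lt_trichotomy i j with hi | rfl | hi
    · exact huj i hi
    · exact h
    · rw [h0 i (by simpa using hi), s0 i hi]
  rcases ha.eq_or_lt with rfl | ha
  · omega
  · have hpos : 0 < ∑ i ∈ Finset.Ico j a, ((m i : ℤ) - 1 - u i) := by
      refine Finset.sum_pos' (fun i _ => by have := ufree i; omega) ⟨j, by simpa using ha, ?_⟩
      have := sfree j
      omega
    omega

end order

/-! ### Counting leading monomials -/

section dimension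

variable {K : Type*} [Field K] {n k : ℕ} {m : Fin n → ℕ}

/-- The coefficients at the `m`-free monomials of degree `d`. -/
def freeCoeffs (K : Type*) [Field K] (m : Fin n → ℕ) (d : ℕ) :
    MvPolynomial (Fin n) K →ₗ[K] (freeOfDegree m d → K) :=
  LinearMap.pi fun w => lcoeff K (Finsupp.equivFunOnFinite.symm w.1)

lemma freeCoeffs_apply (d : ℕ) (f : MvPolynomial (Fin n) K) (w : freeOfDegree m d) :
    freeCoeffs K m d f w = f.coeff (Finsupp.equivFunOnFinite.symm w.1) := rfl

lemma freeCoeffs_eq_zero_of_mem {d : ℕ} {f : MvPolynomial (Fin n) K}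
    (hf : f ∈ purePowerIdeal K m) : freeCoeffs K m d f = 0 := by
  rw [purePowerIdeal_eq, monomialIdeal, mem_ideal_span_monomial_image] at hf
  funext w
  rw [freeCoeffs_apply]
  by_contra hne
  obtain ⟨_, ⟨i, rfl⟩, hi⟩ := hf _ (mem_support_iff.2 hne)
  have h1 := (mem_freeOfDegree.1 w.2).1 i
  have h2 : m i ≤ w.1 i := by simpa using hi i
  omega

/-- The `m`-free exponent vectors of degree `d - k`, none if `d < k`. -/
def shiftedFree (m : Fin n → ℕ) (k d : ℕ) : Finset (Fin n → ℕ) :=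
  if k ≤ d then freeOfDegree m (d - k) else ∅

lemma mem_shiftedFree {d : ℕ} {w : Fin n → ℕ} :
    w ∈ shiftedFree m k d ↔ IsFree m w ∧ ∑ i, w i + k = d := by
  unfold shiftedFree
  split_ifs with h
  · rw [mem_freeOfDegree]
    exact and_congr_right fun _ => by omega
  · simp only [Finset.notMem_empty, false_iff]
    rintro ⟨-, h'⟩
    omega

lemma freeCoeffs_mem_span {d : ℕ} {f : MvPolynomial (Fin n) K} (hf : f ∈ mainIdeal K m k) :
    freeCoeffs K m d f ∈ Submodule.span K ((fun w : Fin n → ℕ => freeCoeffs K m d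
      ((∑ i, X i) ^ k * monomial (Finsupp.equivFunOnFinite.symm w) 1)) ''
        (shiftedFree m k d : Set (Fin n → ℕ))) := by
  rw [mainIdeal, Ideal.span_union, Submodule.mem_sup] at hf
  obtain ⟨p, hp, q, hq, rfl⟩ := hf
  obtain ⟨q, rfl⟩ := Ideal.mem_span_singleton.1 hq
  rw [map_add, freeCoeffs_eq_zero_of_mem hp, zero_add, q.as_sum, Finset.mul_sum, map_sum]
  refine Submodule.sum_mem _ fun u _ => ?_
  have hsmul : monomial u (q.coeff u) = q.coeff u • monomial u (1 : K) := by
    rw [smul_monomial, smul_eq_mul, mul_one]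
  rw [hsmul, mul_smul_comm, map_smul]
  refine Submodule.smul_mem _ _ ?_
  by_cases hu : u ∈ (shiftedFree m k d : Set (Fin n → ℕ)).preimage (fun u : Fin n →₀ ℕ => ⇑u)
  · refine Submodule.subset_span ⟨u, hu, ?_⟩
    simp
  · have hzero : freeCoeffs K m d ((∑ i, X i) ^ k * monomial u (1 : K)) = 0 := by
      by_cases hfree : IsFree m u
      · have hdeg : ∑ i, u i + k ≠ d := fun h => hu (mem_shiftedFree.2 ⟨hfree, h⟩)
        have hhom : ((∑ i, X i : MvPolynomial (Fin n) K) ^ k * monomial u (1 : K)).IsHomogeneous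
            (1 * k + u.degree) :=
          ((IsHomogeneous.sum _ _ _ fun i _ => isHomogeneous_X K i).pow k).mul
            (isHomogeneous_monomial _ rfl)
        funext w
        rw [freeCoeffs_apply]
        refine hhom.coeff_eq_zero ?_
        have hw := (mem_freeOfDegree.1 w.2).2
        rw [Finsupp.degree_eq_sum, Finsupp.degree_eq_sum]
        change ∑ i, w.1 i ≠ _
        omega
      · refine freeCoeffs_eq_zero_of_mem (Ideal.mul_mem_left _ _ ?_)
        rw [purePowerIdeal_eq, monomialIdeal, mem_ideal_span_monomial_image]
        intro v hv
        obtain rfl : v = u := by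
          have := support_monomial_subset hv
          simpa using this
        obtain ⟨i, hi⟩ : ∃ i, m i ≤ v i := by simpa [IsFree] using hfree
        exact ⟨_, ⟨i, rfl⟩, by simpa using hi⟩
    rw [hzero]
    exact Submodule.zero_mem _

/-- Distinct leading monomials make the system triangular. -/
lemma linearIndependent_freeCoeffs (ord : MonomialOrder (Fin n)) {d : ℕ} {T : Finset (Fin n → ℕ)}
    (hT : T ⊆ freeOfDegree m d) {g : (Fin n → ℕ) → MvPolynomial (Fin n) K}
    (hg : ∀ v ∈ T, g v ≠ 0 ∧ ⇑(ord.degree (g v)) = v) :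
    LinearIndependent K fun v : T => freeCoeffs K m d (g v) := by
  classical
  rw [linearIndependent_iff']
  intro s c hsum
  by_contra! hcon
  obtain ⟨v₀, hv₀, hc₀⟩ := hcon
  obtain ⟨v, hv, hmax⟩ := Finset.exists_max_image (s.filter fun v => c v ≠ 0)
    (fun v => ord.toSyn (ord.degree (g v))) ⟨v₀, Finset.mem_filter.2 ⟨hv₀, hc₀⟩⟩
  obtain ⟨hvs, hcv⟩ := Finset.mem_filter.1 hv
  have h := congrFun hsum ⟨v, hT v.2⟩
  rw [Finset.sum_apply, Finset.sum_eq_single v] at h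
  · rw [Pi.smul_apply, freeCoeffs_apply, smul_eq_mul, Pi.zero_apply] at h
    have hdeg : Finsupp.equivFunOnFinite.symm v.1 = ord.degree (g v) :=
      Finsupp.ext fun i => (congrFun (hg v v.2).2 i).symm
    rw [hdeg] at h
    exact mul_ne_zero hcv (ord.coeff_degree_ne_zero_iff.2 (hg v v.2).1) h
  · intro w hw hwv
    by_cases hcw : c w = 0
    · simp [hcw]
    · rw [Pi.smul_apply, freeCoeffs_apply, smul_eq_mul]
      have hdeg : Finsupp.equivFunOnFinite.symm v.1 = ord.degree (g v) :=
        Finsupp.ext fun i => (congrFun (hg v v.2).2 i).symm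
      rw [hdeg, ord.coeff_eq_zero_of_lt, mul_zero]
      refine lt_of_le_of_ne (hmax w (Finset.mem_filter.2 ⟨hw, hcw⟩)) fun h => hwv ?_
      have h := congrArg (fun u : Fin n →₀ ℕ => ⇑u) (ord.toSyn.injective h)
      simp only [(hg v v.2).2, (hg w w.2).2] at h
      exact Subtype.ext h
  · exact fun h => absurd hvs h

/-- If all critical monomials lead elements of `I`, then no other `m`-free monomial does: together
they would be more leading monomials of degree `d` than the dimension of the projection of `I`. -/
lemma exists_gap_le_degree (hk : 1 ≤ k) (ord : MonomialOrder (Fin n))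
    (hlead : ∀ v : Fin n → ℕ, IsFree m v → (∃ a : Fin n, gap m v k a ≤ v a) →
      ∃ g ∈ mainIdeal K m k, g ≠ 0 ∧ ⇑(ord.degree g) = v)
    {f : MvPolynomial (Fin n) K} (hf : f ∈ mainIdeal K m k) (hf0 : f ≠ 0)
    (hfree : IsFree m (ord.degree f)) :
    ∃ a : Fin n, gap m (ord.degree f) k a ≤ ord.degree f a := by
  classical
  by_contra! hcon
  set u : Fin n → ℕ := ⇑(ord.degree f) with hu
  set d := ∑ i, u i with hd
  set C := (freeOfDegree m d).filter fun v => ∃ a : Fin n, gap m v k a ≤ v a with hC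
  have huC : u ∉ C := fun h => by
    obtain ⟨a, ha⟩ := (Finset.mem_filter.1 h).2
    exact absurd (hcon a) (not_lt.2 ha)
  have hT : insert u C ⊆ freeOfDegree m d := Finset.insert_subset
    (mem_freeOfDegree.2 ⟨hfree, rfl⟩) (Finset.filter_subset _ _)
  have hex : ∀ v ∈ insert u C, ∃ g ∈ mainIdeal K m k, g ≠ 0 ∧ ⇑(ord.degree g) = v := by
    intro v hv
    rcases Finset.mem_insert.1 hv with rfl | hv
    · exact ⟨f, hf, hf0, rfl⟩
    · obtain ⟨h1, h2⟩ := Finset.mem_filter.1 hv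
      exact hlead v (mem_freeOfDegree.1 h1).1 h2
  choose! g hgI hg using hex
  have hli := linearIndependent_freeCoeffs (K := K) ord hT hg
  have hcard := linearIndependent_le_span' _ hli (((shiftedFree m k d).image
    fun w : Fin n → ℕ => freeCoeffs K m d ((∑ i, X i) ^ k *
      monomial (Finsupp.equivFunOnFinite.symm w) 1) : Finset _) : Set _) (by
    rintro _ ⟨v, rfl⟩
    rw [Finset.coe_image]
    exact freeCoeffs_mem_span (hgI v v.2))
  have h1 : (insert u C).card ≤ (shiftedFree m k d).card := by
    refine le_trans ?_ (Finset.card_image_le (s := shiftedFree m k d)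
      (f := fun w : Fin n → ℕ => freeCoeffs K m d ((∑ i, X i) ^ k *
        monomial (Finsupp.equivFunOnFinite.symm w) 1)))
    rwa [Cardinal.mk_coe_finset, Nat.cast_le, ← Set.toFinset_card, Finset.toFinset_coe] at hcard
  have h2 : (shiftedFree m k d).card ≤ C.card := by
    unfold shiftedFree
    split_ifs with hkd
    · have := card_freeOfDegree_le_card_critical hk hfree hcon (d - k) (by omega)
      rwa [Nat.sub_add_cancel hkd] at this
    · simp
  rw [Finset.card_insert_of_notMem huC] at h1
  omega

end dimension

/-! ### Monomial ideals and uniqueness of reduced Gröbner bases -/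

section initial

variable {K : Type*} [Field K]

lemma monomial_mem_monomialIdeal_iff {σ : Type*} {S : Set (σ →₀ ℕ)} {t : σ →₀ ℕ} :
    monomial t (1 : K) ∈ monomialIdeal K S ↔ ∃ s ∈ S, s ≤ t := by
  classical
  rw [monomialIdeal, mem_ideal_span_monomial_image]
  simp [support_monomial]

lemma monomialIdeal_le_iff {σ : Type*} {S : Set (σ →₀ ℕ)} {J : Ideal (MvPolynomial σ K)} :
    monomialIdeal K S ≤ J ↔ ∀ s ∈ S, monomial s (1 : K) ∈ J := by
  rw [monomialIdeal, Ideal.span_le]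
  simp [Set.subset_def]

lemma monomialIdeal_congr {σ : Type*} {S T : Set (σ →₀ ℕ)}
    (h : ∀ t, (∃ s ∈ S, s ≤ t) ↔ ∃ s ∈ T, s ≤ t) : monomialIdeal K S = monomialIdeal K T := by
  apply le_antisymm
  · exact monomialIdeal_le_iff.2 fun s hs =>
      monomial_mem_monomialIdeal_iff.2 ((h s).1 ⟨s, hs, le_rfl⟩)
  · exact monomialIdeal_le_iff.2 fun s hs =>
      monomial_mem_monomialIdeal_iff.2 ((h s).2 ⟨s, hs, le_rfl⟩)

lemma isMinimalMonomialGenSet_of_antichain {σ : Type*} {S : Set (σ →₀ ℕ)}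
    (h : ∀ s ∈ S, ∀ t ∈ S, s ≤ t → s = t) : IsMinimalMonomialGenSet S (monomialIdeal K S) := by
  refine ⟨rfl, fun T hT heq => ?_⟩
  obtain ⟨s, hs, hsT⟩ := Set.exists_of_ssubset hT
  have hmem : monomial s (1 : K) ∈ monomialIdeal K T := by
    rw [heq]
    exact monomial_mem_monomialIdeal_iff.2 ⟨s, hs, le_rfl⟩
  obtain ⟨t, ht, hts⟩ := monomial_mem_monomialIdeal_iff.1 hmem
  exact hsT (h t (hT.1 ht) s hs hts ▸ ht)

lemma IsMinimalMonomialGenSet.eq_of_le {σ : Type*} {S : Set (σ →₀ ℕ)}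
    {J : Ideal (MvPolynomial σ K)} (h : IsMinimalMonomialGenSet S J) {s t : σ →₀ ℕ} (hs : s ∈ S)
    (ht : t ∈ S) (hst : s ≤ t) : s = t := by
  by_contra hne
  refine h.2 (S \ {t}) ⟨Set.sdiff_subset, fun hsub => (hsub ht).2 rfl⟩ ?_
  rw [← h.1]
  refine monomialIdeal_congr fun v => ⟨fun ⟨w, hw, hwv⟩ => ⟨w, hw.1, hwv⟩, fun ⟨w, hw, hwv⟩ => ?_⟩
  by_cases hwt : w = t
  · subst hwt
    exact ⟨s, ⟨hs, hne⟩, hst.trans hwv⟩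
  · exact ⟨w, ⟨hw, hwt⟩, hwv⟩

lemma IsMinimalMonomialGenSet.subset {σ : Type*} {S T : Set (σ →₀ ℕ)}
    {J : Ideal (MvPolynomial σ K)} (hS : IsMinimalMonomialGenSet S J)
    (hT : IsMinimalMonomialGenSet T J) : S ⊆ T := by
  intro s hs
  have h1 : monomial s (1 : K) ∈ monomialIdeal K T := by
    rw [hT.1, ← hS.1]
    exact monomial_mem_monomialIdeal_iff.2 ⟨s, hs, le_rfl⟩
  obtain ⟨t, ht, hts⟩ := monomial_mem_monomialIdeal_iff.1 h1
  have h2 : monomial t (1 : K) ∈ monomialIdeal K S := by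
    rw [hS.1, ← hT.1]
    exact monomial_mem_monomialIdeal_iff.2 ⟨t, ht, le_rfl⟩
  obtain ⟨s', hs', hst⟩ := monomial_mem_monomialIdeal_iff.1 h2
  have h3 := hS.eq_of_le hs' hs (hst.trans hts)
  subst h3
  exact le_antisymm hts hst ▸ ht

/-- Elements of two reduced Gröbner bases with the same leading monomial agree: their difference
lies in the ideal, but its leading monomial would be a nonleading monomial of one of them. -/
lemma IsReducedGroebnerBasis.subset {σ : Type*} {ord : MonomialOrder σ}
    {I : Ideal (MvPolynomial σ K)} {B B' : Set (MvPolynomial σ K)}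
    (hB : IsReducedGroebnerBasis ord I B) (hB' : IsReducedGroebnerBasis ord I B') : B ⊆ B' := by
  intro g hg
  obtain ⟨g', hg', hdeg⟩ := hB.minimal.subset hB'.minimal ⟨g, hg, rfl⟩
  suffices h : g - g' = 0 by rwa [sub_eq_zero.1 h]
  by_contra hne
  have hlead : monomial (ord.degree (g - g')) (1 : K) ∈ initialIdeal ord I :=
    monomial_mem_monomialIdeal_iff.2
      ⟨_, ⟨g - g', ⟨I.sub_mem (hB.mem g hg) (hB'.mem g' hg'), hne⟩, rfl⟩, le_rfl⟩
  have hcoeff := ord.coeff_degree_ne_zero_iff.2 hne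
  have hnedeg : ord.degree (g - g') ≠ ord.degree g := by
    intro h
    have h1 : g.coeff (ord.degree g) = 1 := hB.monic g hg
    have h2 : g'.coeff (ord.degree g') = 1 := hB'.monic g' hg'
    rw [h, coeff_sub, h1, ← hdeg, h2, sub_self] at hcoeff
    exact hcoeff rfl
  rw [coeff_sub] at hcoeff
  by_cases h : g.coeff (ord.degree (g - g')) = 0
  · refine hB'.tail g' hg' _ ?_ (hdeg ▸ hnedeg) hlead
    rw [mem_support_iff]
    intro h'
    rw [h, h', sub_self] at hcoeff
    exact hcoeff rfl
  · exact hB.tail g hg _ (mem_support_iff.2 h) hnedeg hlead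

lemma IsReducedGroebnerBasis.eq_iff {σ : Type*} {ord : MonomialOrder σ}
    {I : Ideal (MvPolynomial σ K)} {B B' : Set (MvPolynomial σ K)}
    (hB' : IsReducedGroebnerBasis ord I B') : IsReducedGroebnerBasis ord I B ↔ B = B' :=
  ⟨fun hB => (hB.subset hB').antisymm (hB'.subset hB), fun h => h ▸ hB'⟩

end initial

/-! ### The Gröbner basis -/

section main

variable {K : Type*} [Field K] [CharZero K] {n k : ℕ} {m : Fin n → ℕ} (ord : MonomialOrder (Fin n))
  (hord : ∀ i j : Fin n, i < j →
    ord.toSyn (Finsupp.single j 1) < ord.toSyn (Finsupp.single i 1))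

omit [CharZero K] in
lemma degree_X_pow (i : Fin n) (p : ℕ) :
    ord.degree (X i ^ p : MvPolynomial (Fin n) K) = Finsupp.single i p := by
  classical
  rw [X_pow_eq_monomial, ord.degree_monomial, if_neg one_ne_zero]

include hord in
lemma exists_mem_basisG_degree_eq (hk : 1 ≤ k) {s : Fin n →₀ ℕ} (hs : s ∈ minGens m k) :
    ∃ g ∈ basisG K m k, ord.degree g = s := by
  simp only [minGens, Set.mem_union, Set.mem_image, Set.mem_iUnion] at hs
  rcases hs with ⟨j, hj, rfl⟩ | ⟨j, hs⟩
  · exact ⟨_, Or.inl ⟨j, hj, rfl⟩, degree_X_pow ord j _⟩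
  · exact ⟨_, Or.inr (Set.mem_iUnion.2 ⟨j, s, hs, rfl⟩), degree_gPoly ord hord hk hs⟩

include hord in
lemma basisG_spec (hk : 1 ≤ k) {g : MvPolynomial (Fin n) K} (hg : g ∈ basisG K m k) :
    g ∈ mainIdeal K m k ∧ ord.leadingCoeff g = 1 ∧ ord.degree g ∈ minGens m k ∧
      ∀ u ∈ g.support, u ≠ ord.degree g → IsFree m u ∧ ∀ a : Fin n, (u a : ℤ) < gap m u k a := by
  simp only [basisG, Set.mem_union, Set.mem_image, Set.mem_iUnion] at hg
  rcases hg with ⟨j, hj, rfl⟩ | ⟨j, s, hs, rfl⟩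
  · refine ⟨Ideal.subset_span (Or.inl ⟨j, rfl⟩), ?_, ?_, ?_⟩
    · rw [X_pow_eq_monomial, ord.leadingCoeff_monomial]
    · rw [degree_X_pow]
      exact Or.inl ⟨j, hj, rfl⟩
    · intro u hu hne
      rw [degree_X_pow] at hne
      rw [X_pow_eq_monomial] at hu
      exact absurd (by simpa using support_monomial_subset hu) hne
  · obtain ⟨sfree, sj, s0, -⟩ := (mem_crit_iff hk).1 hs
    have hdeg := degree_gPoly (K := K) ord hord hk hs
    refine ⟨gPoly_mem hk sfree s0 sj, leadingCoeff_gPoly ord hord hk hs, ?_, ?_⟩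
    · rw [hdeg]
      exact Or.inr (Set.mem_iUnion.2 ⟨j, hs⟩)
    · intro u hu hne
      rw [hdeg] at hne
      exact ⟨(of_mem_support_gPoly sfree s0 hu).2.1, lt_gap_of_mem_support_gPoly hk hs hu hne⟩

include hord in
lemma exists_mem_mainIdeal_degree_eq (hk : 1 ≤ k) {s t : Fin n →₀ ℕ} (hs : s ∈ minGens m k)
    (hst : s ≤ t) : ∃ f ∈ mainIdeal K m k, f ≠ 0 ∧ ord.degree f = t := by
  obtain ⟨g, hg, rfl⟩ := exists_mem_basisG_degree_eq (K := K) ord hord hk hs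
  obtain ⟨h1, h2, -⟩ := basisG_spec ord hord hk hg
  have hg0 : g ≠ 0 := by
    rw [← ord.leadingCoeff_ne_zero_iff, h2]
    exact one_ne_zero
  have hmon : monomial (t - ord.degree g) (1 : K) ≠ 0 := by simp
  refine ⟨monomial (t - ord.degree g) 1 * g, Ideal.mul_mem_left _ _ h1, mul_ne_zero hmon hg0, ?_⟩
  classical
  rw [ord.degree_mul hmon hg0, ord.degree_monomial, if_neg one_ne_zero, tsub_add_cancel_of_le hst]

include hord in
theorem initialIdeal_eq_monomialIdeal_minGens (hk : 1 ≤ k) (hm : ∀ i, 2 ≤ m i) :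
    initialIdeal ord (mainIdeal K m k) = monomialIdeal K (minGens m k) := by
  refine monomialIdeal_congr fun t => ⟨?_, ?_⟩
  · rintro ⟨_, ⟨f, ⟨hf, hf0⟩, rfl⟩, hft⟩
    have hlead : ∀ v : Fin n → ℕ, IsFree m v → (∃ a : Fin n, gap m v k a ≤ v a) →
        ∃ g ∈ mainIdeal K m k, g ≠ 0 ∧ ⇑(ord.degree g) = v := by
      intro v hv hcrit
      obtain ⟨s, hs, hst⟩ := (exists_minGens_le_iff hk hm
        (t := Finsupp.equivFunOnFinite.symm v)).2 fun _ => hcrit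
      obtain ⟨g, hg, hg0, hdeg⟩ := exists_mem_mainIdeal_degree_eq (K := K) ord hord hk hs hst
      exact ⟨g, hg, hg0, by rw [hdeg]; rfl⟩
    obtain ⟨s, hs, hsf⟩ := (exists_minGens_le_iff hk hm).2
      (exists_gap_le_degree hk ord hlead hf hf0)
    exact ⟨s, hs, hsf.trans hft⟩
  · rintro ⟨s, hs, hst⟩
    obtain ⟨f, hf, hf0, hdeg⟩ := exists_mem_mainIdeal_degree_eq (K := K) ord hord hk hs hst
    exact ⟨t, ⟨f, ⟨hf, hf0⟩, hdeg⟩, le_rfl⟩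

omit [CharZero K] in
lemma criticalIdeal_eq_monomialIdeal_minGens (hk : 1 ≤ k) (hm : ∀ i, 2 ≤ m i) :
    criticalIdeal K m k = monomialIdeal K (minGens m k) := by
  rw [criticalIdeal, purePowerIdeal_eq, monomialIdeal, monomialIdeal, ← Ideal.span_union,
    ← Set.image_union]
  refine monomialIdeal_congr fun t => (Iff.trans ?_ (exists_minGens_le_iff hk hm).symm)
  constructor
  · rintro ⟨s, hs | ⟨i, rfl⟩, hst⟩ ht
    · obtain ⟨j, r, hr, hrs⟩ := exists_crit_le hk hs.1 ((isCritical_iff hk).1 hs).2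
      exact ⟨j, gap_le_of_crit_le hk hr (hrs.trans hst)⟩
    · have : m i ≤ t i := by simpa using hst i
      exact absurd (ht i) (not_lt.2 this)
  · intro h
    by_cases ht : IsFree m t
    · exact ⟨t, Or.inl ((isCritical_iff hk).2 ⟨ht, h ht⟩), le_rfl⟩
    · obtain ⟨i, hi⟩ : ∃ i, m i ≤ t i := by simpa [IsFree] using ht
      exact ⟨_, Or.inr ⟨i, rfl⟩, by simpa using hi⟩

include hord in
theorem isReducedGroebnerBasis_basisG (hk : 1 ≤ k) (hm : ∀ i, 2 ≤ m i) :
    IsReducedGroebnerBasis ord (mainIdeal K m k) (basisG K m k) where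
  finite := by
    refine (Set.toFinite _).union (Set.finite_iUnion fun j => Set.Finite.image _ ?_)
    refine (Set.finite_Iic (Finsupp.equivFunOnFinite.symm m)).subset fun s hs i => ?_
    exact (((mem_crit_iff hk).1 hs).1 i).le
  mem g hg := (basisG_spec ord hord hk hg).1
  ne_zero g hg := by
    rw [← ord.leadingCoeff_ne_zero_iff, (basisG_spec ord hord hk hg).2.1]
    exact one_ne_zero
  minimal := by
    have himage : ord.degree '' basisG K m k = minGens m k := by
      apply Set.Subset.antisymm
      · rintro _ ⟨g, hg, rfl⟩
        exact (basisG_spec ord hord hk hg).2.2.1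
      · exact fun s hs => exists_mem_basisG_degree_eq ord hord hk hs
    rw [himage, initialIdeal_eq_monomialIdeal_minGens ord hord hk hm]
    exact isMinimalMonomialGenSet_of_antichain fun s hs t ht => isAntichain_minGens hk hm hs ht
  monic g hg := (basisG_spec ord hord hk hg).2.1
  tail g hg u hu hne hmem := by
    rw [initialIdeal_eq_monomialIdeal_minGens ord hord hk hm] at hmem
    obtain ⟨hfree, hlt⟩ := (basisG_spec ord hord hk hg).2.2.2 u hu hne
    obtain ⟨a, ha⟩ := (exists_minGens_le_iff hk hm).1 (monomial_mem_monomialIdeal_iff.1 hmem) hfree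
    exact absurd (hlt a) (not_lt.2 ha)

end main

end CritPath

end

theorem theorem1p1 {K : Type*} [Field K] [CharZero K] (n k : ℕ) (hn : 1 ≤ n) (hk : 1 ≤ k)
    (m : Fin n → ℕ) (hm : ∀ i, 2 ≤ m i) (ord : MonomialOrder (Fin n))
    (hord : ∀ i j : Fin n, i < j →
      ord.toSyn (Finsupp.single j 1) < ord.toSyn (Finsupp.single i 1)) :
    (∀ B : Set (MvPolynomial (Fin n) K),
      CritPath.IsReducedGroebnerBasis ord (CritPath.mainIdeal K m k) B ↔
        B = CritPath.basisG K m k) ∧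
    CritPath.initialIdeal ord (CritPath.mainIdeal K m k) = CritPath.criticalIdeal K m k ∧
    CritPath.IsMinimalMonomialGenSet (CritPath.minGens m k)
      (CritPath.initialIdeal ord (CritPath.mainIdeal K m k)) := by
  have hin := CritPath.initialIdeal_eq_monomialIdeal_minGens (K := K) ord hord hk hm
  refine ⟨fun B => (CritPath.isReducedGroebnerBasis_basisG ord hord hk hm).eq_iff,
    hin.trans (CritPath.criticalIdeal_eq_monomialIdeal_minGens hk hm).symm, ?_⟩
  rw [hin]
  exact CritPath.isMinimalMonomialGenSet_of_antichain fun s hs t ht =>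
    CritPath.isAntichain_minGens hk hm hs ht
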